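/- For $x\in\mathbb R^d$ let $\|x\|_p=(\sum_i|x_i|^p)^{1/p}$, and let $D_G(x,y)=G(x)-G(y)-\langle\nabla G(y),x-y\rangle$. Consider a dimension $d$, a continuously differentiable $F:\mathbb R^d\to\mathbb R$ and points $x_1,x_\star$ with $\|x_1\|_p,\|x_\star\|_p\le R$ such that $x_\star$ is a global minimizer of $F$, $F$ is $\tau$-star-convex about $x_\star$, i.e. $\tau\langle\nabla F(x),x-x_\star\rangle\ge F(x)-F(x_\star)$ for all $x$, and $F$ is $(L,\kappa)$-weakly smooth, i.e. $|D_F(x,y)|\le\frac L\kappa\|x-y\|_p^\kappa$ for all $x,y$. Here $L,\tau,R>0$, and $\varepsilon>0$ is the accuracy. **Algorithm** (accelerated mirror descent with binary search; order $q$, constant $\mu$, $\psi(x)=\frac1q\|x\|_p^q$; input: number of iterations $T\ge 0$, parameters $C_t\ge0$ and $\epsilon_t,\alpha_t,\eta_t>0$). Put $x_1^{ag}=x_1$. For $t=1,\dots,T$: find $\lambda_t\in[0,1]$ by the binary search below; put $x_t^{md}=\lambda_tx_t^{ag}+(1-\lambda_t)x_t$, $x_{t+1}=\arg\min_x\{\eta_t\langle\nabla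 F(x_t^{md}),x\rangle+D_\psi(x,x_t)\}$ and $x_{t+1}^{ag}=\arg\min_x\{\alpha_t\langle\nabla F(x_t^{md}),x\rangle+\frac\mu q\|x-x_t^{md}\|_p^q\}$. Return $x_{T+1}^{ag}$. Binary search: let $g(\lambda)=F(\lambda x_t^{ag}+(1-\lambda)x_t)-F(x_t^{ag})$. If $g'(1)\le\epsilon_t$, return $1$; else if $C_tg(0)\le\epsilon_t$, return $0$; else start with $[a,b]=[0,1]$ and repeat: $\lambda=\frac{a+b}2$; if $\lambda g'(\lambda)+C_tg(\lambda)\le\epsilon_t$, return $\lambda$; else if $g(\lambda)>0$, set $a=\lambda$; else set $b=\lambda$. **Statement.** (i) For every $1<\kappa<2$ there is a constant $M$ depending only on $\kappa$ such that, for all $1<p\le2$ and all $L,\tau,R,\varepsilon>0$, there are $T$ and input parameters, depending only on $p,\kappa,L,\tau,R,\varepsilon$, with which the algorithm with $q=2$, $\mu=p-1$ terminates for all $d,F,x_1,x_\star$ as above and returns a point $y$ with $F(y)\le F(x_\star)+\varepsilon$ after at most $$M\,X^{\frac{2}{3\kappa-2}}\log^2(2+X),\qquad X=\frac{L\tau^2R^\kappa}{(p-1)^{\kappa/2}\varepsilon},$$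 evaluations of function values and gradients; and if $\frac{L\tau R}{\varepsilon}\ge\max\{2,\tau,R,\frac1{p-1}\}$, the same run makes at most $M\,X^{\frac{2}{3\kappa-2}}\log^2\big(\frac{L\tau R}{\varepsilon}\big)$ evaluations. (ii) For every $p>2$ and $1<\kappa\le2$ there is a constant $M$ depending only on $p,\kappa$ such that, for all $L,\tau,R,\varepsilon>0$, there are $T$ and input parameters, depending only on $p,\kappa,L,\tau,R,\varepsilon$, with which the algorithm with $q=p$, $\mu=2^{-p(p-2)/(p-1)}$ terminates for all $d,F,x_1,x_\star$ as above and returns a point $y$ with $F(y)\le F(x_\star)+\varepsilon$ after at most $$M\,X^{\frac{p}{\kappa p+\kappa-p}}\log^2(2+X),\qquad X=\frac{L\tau^pR^\kappa}{\varepsilon},$$ evaluations of function values and gradients; and if $\frac{L\tau R}{\varepsilon}\ge\max\{2,\tau,R\}$, the same run makes at most $M\,X^{\frac{p}{\kappa p+\kappa-p}}\log^2\big(\frac{L\tau R}{\varepsilon}\big)$ evaluations. -/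

import Mathlib

namespace StarConvexAcc

noncomputable section

/-- The space `ℝ^d`; its inner product is the standard scalar product, and gradients are taken
with respect to it. The norms used below are the `p`-norms `lpNorm`, not the built-in one. -/
abbrev Vec (d : ℕ) : Type := EuclideanSpace ℝ (Fin d)

/-- The `p`-norm `(∑ i, |x i| ^ p) ^ (1 / p)` on `ℝ^d`. -/
def lpNorm (p : ℝ) {d : ℕ} (x : Vec d) : ℝ :=
  (∑ i, |x i| ^ p) ^ (1 / p)

/-- Bregman divergence `D_F(x, y) = F x - F y - ⟨∇F y, x - y⟩`. -/
def bregman {d : ℕ} (F : Vec d → ℝ) (x y : Vec d) : ℝ :=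
  F x - F y - inner ℝ (gradient F y) (x - y)

/-- `F` is continuously differentiable and `τ`-star-convex, and `xs` is a minimizer which
witnesses this. -/
structure IsStarConvexAbout (τ : ℝ) {d : ℕ} (F : Vec d → ℝ) (xs : Vec d) : Prop where
  contDiff : ContDiff ℝ 1 F
  isMin : ∀ x, F xs ≤ F x
  star : ∀ x, F x - F xs ≤ τ * inner ℝ (gradient F x) (x - xs)

/-- `F` is continuously differentiable and `(L, κ)`-weakly smooth with respect to the `p`-norm. -/
structure IsWeaklySmooth (p L κ : ℝ) {d : ℕ} (F : Vec d → ℝ) : Prop where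
  contDiff : ContDiff ℝ 1 F
  bound : ∀ x y, |bregman F x y| ≤ L / κ * lpNorm p (x - y) ^ κ

/-- The distance-generating function `ψ(x) = ‖x‖_p ^ q / q`. -/
def dgf (p q : ℝ) {d : ℕ} (x : Vec d) : ℝ :=
  lpNorm p x ^ q / q

/-- The restriction of the objective to the line through the two endpoints of the search,
`g(lam) = F(lam * xag + (1 - lam) * x) - F(xag)`. -/
def lineFun {d : ℕ} (F : Vec d → ℝ) (x xag : Vec d) (lam : ℝ) : ℝ :=
  F (lam • xag + (1 - lam) • x) - F xag

/-- The derivative of `lineFun`, as it is obtained from one gradient evaluation. -/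
def lineDeriv {d : ℕ} (F : Vec d → ℝ) (x xag : Vec d) (lam : ℝ) : ℝ :=
  inner ℝ (gradient F (lam • xag + (1 - lam) • x)) (xag - x)

/-- The stopping test `lam * g'(lam) + C * g(lam) ≤ e` of the binary search. Since
`lam * (xag - x) = xmd - x` at `xmd = lam * xag + (1 - lam) * x`, it is
`⟨∇F(xmd), xmd - x⟩ + C * (F(xmd) - F(xag)) ≤ e`. -/
def SearchTest {d : ℕ} (F : Vec d → ℝ) (x xag : Vec d) (C e lam : ℝ) : Prop :=
  lam * lineDeriv F x xag lam + C * lineFun F x xag lam ≤ e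

/-- Execution of the loop of the binary search. `SearchLoop F x xag C e a b lam n` says that the
loop, entered with the interval `[a, b]`, terminates, returns `lam`, and makes `n` evaluations.
Each pass makes three of them: the gradient at the midpoint (for `g'`), and the values at the
midpoint and at `xag` (for `g`). A loop that does not terminate has no execution. -/
inductive SearchLoop {d : ℕ} (F : Vec d → ℝ) (x xag : Vec d) (C e : ℝ) :
    ℝ → ℝ → ℝ → ℕ → Prop
  | found (a b : ℝ) (h : SearchTest F x xag C e ((a + b) / 2)) :
      SearchLoop F x xag C e a b ((a + b) / 2) 3
  | upper (a b lam : ℝ) (n : ℕ) (h : ¬ SearchTest F x xag C e ((a + b) / 2))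
      (hg : 0 < lineFun F x xag ((a + b) / 2))
      (hrec : SearchLoop F x xag C e ((a + b) / 2) b lam n) :
      SearchLoop F x xag C e a b lam (n + 3)
  | lower (a b lam : ℝ) (n : ℕ) (h : ¬ SearchTest F x xag C e ((a + b) / 2))
      (hg : ¬ 0 < lineFun F x xag ((a + b) / 2))
      (hrec : SearchLoop F x xag C e a ((a + b) / 2) lam n) :
      SearchLoop F x xag C e a b lam (n + 3)

/-- Execution of the generalized binary search: it terminates, returns `lam`, and makes `n`
evaluations of the value and of the gradient of `F`. The test at `1` takes one gradient, the test
at `0` two values. -/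
inductive BinarySearch {d : ℕ} (F : Vec d → ℝ) (x xag : Vec d) (C e : ℝ) : ℝ → ℕ → Prop
  | atOne (h1 : lineDeriv F x xag 1 ≤ e) : BinarySearch F x xag C e 1 1
  | atZero (h1 : ¬ lineDeriv F x xag 1 ≤ e) (h0 : C * lineFun F x xag 0 ≤ e) :
      BinarySearch F x xag C e 0 3
  | loop (lam : ℝ) (n : ℕ) (h1 : ¬ lineDeriv F x xag 1 ≤ e) (h0 : ¬ C * lineFun F x xag 0 ≤ e)
      (hl : SearchLoop F x xag C e 0 1 lam n) :
      BinarySearch F x xag C e lam (n + 3)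

/-- Input parameters of the accelerated method: the parameters `C t`, `eps t` of the binary search
and the step sizes `α t`, `η t`, for `t ≥ 1`. -/
structure Params where
  C : ℕ → ℝ
  eps : ℕ → ℝ
  α : ℕ → ℝ
  η : ℕ → ℝ

/-- Admissible input parameters. -/
structure Params.Valid (P : Params) : Prop where
  C_nonneg : ∀ t, 0 ≤ P.C t
  eps_pos : ∀ t, 0 < P.eps t
  α_pos : ∀ t, 0 < P.α t
  η_pos : ∀ t, 0 < P.η t

/-- Accelerated mirror descent with binary search, for the `p`-norm, the order `q`, the constant
`μ` and the distance-generating function `dgf p q`, started at `x1`.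
`Run p q μ P F x1 t x xag n` says that after `t` iterations the method has reached the iterates
`x = x_{t+1}` and `xag = x_{t+1}^{ag}` and has made `n` evaluations of the value and of the
gradient of `F`. Besides those of the binary search, each iteration evaluates the gradient at
`x_t^{md}` for the mirror step and for the proximal step. -/
inductive Run (p q μ : ℝ) (P : Params) {d : ℕ} (F : Vec d → ℝ) (x1 : Vec d) :
    ℕ → Vec d → Vec d → ℕ → Prop
  | init : Run p q μ P F x1 0 x1 x1 0
  | step (t : ℕ) (x xag : Vec d) (n : ℕ) (lam : ℝ) (m : ℕ) (xmd x' xag' : Vec d)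
      (hprev : Run p q μ P F x1 t x xag n)
      (hsearch : BinarySearch F x xag (P.C (t + 1)) (P.eps (t + 1)) lam m)
      (hmd : xmd = lam • xag + (1 - lam) • x)
      (hmirror : ∀ z, P.η (t + 1) * inner ℝ (gradient F xmd) x' + bregman (dgf p q) x' x ≤
        P.η (t + 1) * inner ℝ (gradient F xmd) z + bregman (dgf p q) z x)
      (hprox : ∀ z,
        P.α (t + 1) * inner ℝ (gradient F xmd) xag' + μ / q * lpNorm p (xag' - xmd) ^ q ≤
        P.α (t + 1) * inner ℝ (gradient F xmd) z + μ / q * lpNorm p (z - xmd) ^ q) :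
      Run p q μ P F x1 (t + 1) x' xag' (n + m + 2)

/-- The method, run for `T` iterations from `x1`, returns `y` after `n` evaluations in total. -/
def Returns (p q μ : ℝ) (P : Params) (T : ℕ) {d : ℕ} (F : Vec d → ℝ) (x1 y : Vec d) (n : ℕ) :
    Prop :=
  ∃ x, Run p q μ P F x1 T x y n

/-- With input parameters `P` and `T` iterations, the method solves the whole problem class to
accuracy `ε` within `N` evaluations: in every dimension `d`, for every `τ`-star-convex,
`(L, κ)`-weakly smooth `F` with star center `xs` and for every starting point `x1`, both in the
`p`-ball of radius `R`, the method terminates, and what it returns is `ε`-optimal and was obtained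
with at most `N` evaluations of the value and of the gradient of `F`. -/
def SolvesWithin (p q μ κ L τ R ε : ℝ) (P : Params) (T : ℕ) (N : ℝ) : Prop :=
  ∀ (d : ℕ) (F : Vec d → ℝ) (x1 xs : Vec d),
    IsStarConvexAbout τ F xs → IsWeaklySmooth p L κ F →
    lpNorm p x1 ≤ R → lpNorm p xs ≤ R →
    (∃ y n, Returns p q μ P T F x1 y n) ∧
    ∀ y n, Returns p q μ P T F x1 y n → F y ≤ F xs + ε ∧ (n : ℝ) ≤ N

end

end StarConvexAcc

/-! Write Γ_t = γ t^q and η_{t+1} = Γ_{t+1} - Γ_t. The potential Γ_t (F(x^ag) - F(x_*)) + τ D_ψ(x_*,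
x) increases in one iteration only by small errors (`potential_step`). Star convexity at x^md bounds
F(x^md) - F(x_*) by τ⟨∇F(x^md), x^md - x_*⟩, and x^md - x_* is split into three pieces. The piece
x^md - x is controlled by the search test with C = Γ_t / (τ η_{t+1}). The piece x - x' is paid for
by the decrease in the proximal step together with the uniform convexity of ψ. The piece x' - x_* is
controlled by the three-point inequality of the mirror step.

The proximal step wants smoothness of order q, while F has order κ < q. Young's inequality at a
scale u bridges the gap at the price of an additive error δ proportional to u^κ (`young_rpow`). With
search accuracy ε/(4τ) and δ = ε/(4T) the accumulated error is Γ_T ε/2. The initial potential is at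
most Γ_T ε/2 once T^{(κq+κ-q)/κ} is at least a constant times X^{q/κ}, which is the source of the
exponent q/(κq+κ-q) (`Nontrivial.progress`).

Each search costs O(log(2+X)) evaluations, although F need not be convex. While the loop runs, g is
positive at the left end, and at the right end g is nonpositive with positive slope. Hence the
interval contains a critical point with g ≤ 0, and near it weak smoothness makes the test succeed
(`exists_lineDeriv_eq_zero`, `IsWeaklySmooth.searchTest_of_close`). The number of halvings is
logarithmic because the distance between the two iterates grows only polynomially in T
(`RunConst.dist_le`, `ProxConst.dist_step`); this is where κ < q is needed strictly.

The uniform convexity of ψ comes from one-dimensional inequalities for |·|^p (`bregman_dgf_self_ge`,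
`bregman_dgf_two_ge`). For p ≤ 2 the convexity constant is (p-1)/20, not the sharp p-1; the lost
factor enters the step sizes and the final constant, not the rate. -/

namespace StarConvexAcc

/-! ### Elementary facts on the p-norm -/

section Norm

variable {d : ℕ} {p : ℝ}

lemma sum_abs_rpow_nonneg (p : ℝ) (x : Vec d) : 0 ≤ ∑ i, |x i| ^ p :=
  Finset.sum_nonneg fun _ _ => Real.rpow_nonneg (abs_nonneg _) _

lemma lpNorm_nonneg (p : ℝ) (x : Vec d) : 0 ≤ lpNorm p x :=
  Real.rpow_nonneg (sum_abs_rpow_nonneg p x) _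

lemma lpNorm_rpow (p q : ℝ) (x : Vec d) :
    lpNorm p x ^ q = (∑ i, |x i| ^ p) ^ (q / p) := by
  rw [lpNorm, ← Real.rpow_mul (sum_abs_rpow_nonneg p x)]
  congr 1
  ring

lemma lpNorm_rpow_self (hp : p ≠ 0) (x : Vec d) : lpNorm p x ^ p = ∑ i, |x i| ^ p := by
  rw [lpNorm_rpow, div_self hp, Real.rpow_one]

lemma lpNorm_zero (hp : 0 < p) : lpNorm p (0 : Vec d) = 0 := by
  have h : ∑ i : Fin d, |(0 : Vec d) i| ^ p = 0 :=
    Finset.sum_eq_zero fun i _ => by simp [Real.zero_rpow hp.ne']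
  rw [lpNorm, h, Real.zero_rpow (one_div_pos.2 hp).ne']

lemma lpNorm_smul (hp : 0 < p) (c : ℝ) (x : Vec d) : lpNorm p (c • x) = |c| * lpNorm p x := by
  have h : ∑ i, |(c • x) i| ^ p = |c| ^ p * ∑ i, |x i| ^ p := by
    rw [Finset.mul_sum]
    refine Finset.sum_congr rfl fun i _ => ?_
    rw [PiLp.smul_apply, smul_eq_mul, abs_mul, Real.mul_rpow (abs_nonneg _) (abs_nonneg _)]
  rw [lpNorm, h, Real.mul_rpow (Real.rpow_nonneg (abs_nonneg _) _) (sum_abs_rpow_nonneg p x),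
    ← Real.rpow_mul (abs_nonneg _), mul_one_div_cancel hp.ne', Real.rpow_one, lpNorm]

lemma lpNorm_neg (hp : 0 < p) (x : Vec d) : lpNorm p (-x) = lpNorm p x := by
  simpa using lpNorm_smul hp (-1) x

lemma lpNorm_sub_comm (hp : 0 < p) (x y : Vec d) : lpNorm p (x - y) = lpNorm p (y - x) := by
  rw [← lpNorm_neg hp, neg_sub]

lemma lpNorm_add_le (hp : 1 ≤ p) (x y : Vec d) :
    lpNorm p (x + y) ≤ lpNorm p x + lpNorm p y := by
  simpa [lpNorm] using Real.Lp_add_le Finset.univ (fun i => x i) (fun i => y i) hp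

lemma lpNorm_sub_le (hp : 1 ≤ p) (x y : Vec d) :
    lpNorm p (x - y) ≤ lpNorm p x + lpNorm p y := by
  simpa [sub_eq_add_neg, lpNorm_neg (zero_lt_one.trans_le hp)] using lpNorm_add_le hp x (-y)

lemma lpNorm_sub_le_add (hp : 1 ≤ p) (x y z : Vec d) :
    lpNorm p (x - z) ≤ lpNorm p (x - y) + lpNorm p (y - z) := by
  simpa using lpNorm_add_le hp (x - y) (y - z)

lemma abs_apply_le_lpNorm (hp : 0 < p) (x : Vec d) (i : Fin d) : |x i| ≤ lpNorm p x := by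
  have h : |x i| ^ p ≤ ∑ j, |x j| ^ p :=
    Finset.single_le_sum (f := fun j => |x j| ^ p)
      (fun j _ => Real.rpow_nonneg (abs_nonneg _) _) (Finset.mem_univ i)
  have := Real.rpow_le_rpow (Real.rpow_nonneg (abs_nonneg _) _) h (one_div_pos.2 hp).le
  rwa [← Real.rpow_mul (abs_nonneg _), mul_one_div_cancel hp.ne', Real.rpow_one] at this

lemma norm_le_mul_lpNorm (hp : 0 < p) (x : Vec d) : ‖x‖ ≤ √d * lpNorm p x := by
  rw [EuclideanSpace.norm_eq]
  have h : ∑ i, ‖x i‖ ^ 2 ≤ d * lpNorm p x ^ 2 := by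
    calc ∑ i, ‖x i‖ ^ 2 ≤ ∑ _i : Fin d, lpNorm p x ^ 2 :=
          Finset.sum_le_sum fun i _ => by
            have := abs_apply_le_lpNorm hp x i
            rw [Real.norm_eq_abs]
            gcongr
      _ = _ := by simp
  calc √(∑ i, ‖x i‖ ^ 2) ≤ √(d * lpNorm p x ^ 2) := Real.sqrt_le_sqrt h
    _ = _ := by rw [Real.sqrt_mul (by positivity), Real.sqrt_sq (lpNorm_nonneg p x)]

lemma lpNorm_eq_zero (hp : 0 < p) {x : Vec d} (h : lpNorm p x = 0) : x = 0 := by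
  have := norm_le_mul_lpNorm hp x
  rw [h, mul_zero] at this
  exact norm_le_zero_iff.1 this

lemma continuous_lpNorm (hp : 0 < p) : Continuous (lpNorm p : Vec d → ℝ) := by
  have h : Continuous fun x : Vec d => ∑ i, |x i| ^ p :=
    continuous_finsetSum _ fun i _ =>
      ((EuclideanSpace.proj (𝕜 := ℝ) i).continuous.abs).rpow_const fun _ => Or.inr hp.le
  exact h.rpow_const fun _ => Or.inr (one_div_pos.2 hp).le

end Norm

/-! ### The gradient of the distance-generating function -/

section Gradient

variable {d : ℕ} {p q : ℝ}

/-- The pairing of the gradient of `‖·‖_p ^ p / p` at `x` with `v`. -/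
noncomputable def powPairing (p : ℝ) {d : ℕ} (x v : Vec d) : ℝ :=
  ∑ i, |x i| ^ (p - 2) * x i * v i

lemma hasFDerivAt_sum_abs_rpow (hp : 1 < p) (x : Vec d) :
    HasFDerivAt (fun y : Vec d => ∑ i, |y i| ^ p)
      (∑ i, (p * |x i| ^ (p - 2) * x i) • (EuclideanSpace.proj i : Vec d →L[ℝ] ℝ)) x :=
  HasFDerivAt.fun_sum fun i _ =>
    (hasDerivAt_abs_rpow (x i) hp).comp_hasFDerivAt (f := fun y : Vec d => y i) x
      (EuclideanSpace.proj i : Vec d →L[ℝ] ℝ).hasFDerivAt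

lemma dgf_eq (p q : ℝ) (x : Vec d) : dgf p q x = (∑ i, |x i| ^ p) ^ (q / p) / q := by
  rw [dgf, lpNorm_rpow]

/-- Because q / p ≥ 1, the outer power is differentiable even where the sum vanishes, so the origin
needs no separate treatment. -/
lemma hasFDerivAt_dgf (hp : 1 < p) (hpq : p ≤ q) (x : Vec d) :
    HasFDerivAt (dgf p q)
      (q⁻¹ • ((q / p * (∑ i, |x i| ^ p) ^ (q / p - 1)) •
        ∑ i, (p * |x i| ^ (p - 2) * x i) • (EuclideanSpace.proj i : Vec d →L[ℝ] ℝ))) x := by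
  have hp0 : 0 < p := by linarith
  have h := ((hasFDerivAt_sum_abs_rpow hp x).rpow_const (p := q / p)
    (Or.inr ((one_le_div hp0).2 hpq))).const_mul q⁻¹
  refine h.congr_of_eventuallyEq (Filter.Eventually.of_forall fun y => ?_)
  simp only [dgf_eq, div_eq_inv_mul]

lemma differentiableAt_dgf (hp : 1 < p) (hpq : p ≤ q) (x : Vec d) :
    DifferentiableAt ℝ (dgf p q) x :=
  (hasFDerivAt_dgf hp hpq x).differentiableAt

lemma inner_gradient_dgf (hp : 1 < p) (hpq : p ≤ q) (x v : Vec d) :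
    inner ℝ (gradient (dgf p q) x) v =
      (∑ i, |x i| ^ p) ^ (q / p - 1) * powPairing p x v := by
  have hp0 : 0 < p := by linarith
  have hq0 : 0 < q := by linarith
  rw [inner_gradient_left, (hasFDerivAt_dgf hp hpq x).fderiv]
  simp only [smul_apply, sum_apply, smul_eq_mul, powPairing]
  have : ∑ i, p * |x i| ^ (p - 2) * x i * v i = p * ∑ i, |x i| ^ (p - 2) * x i * v i := by
    rw [Finset.mul_sum]
    exact Finset.sum_congr rfl fun i _ => by ring
  have h (i : Fin d) : (EuclideanSpace.proj i : Vec d →L[ℝ] ℝ) v = v i := rfl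
  simp only [h, this]
  field_simp

lemma powPairing_self (hp : 1 < p) (x : Vec d) : powPairing p x x = ∑ i, |x i| ^ p := by
  refine Finset.sum_congr rfl fun i _ => ?_
  rcases eq_or_ne (x i) 0 with h | h
  · simp [h, Real.zero_rpow (by linarith : p ≠ 0)]
  · rw [mul_assoc, ← abs_mul_abs_self (x i), ← pow_two, ← Real.rpow_natCast,
      ← Real.rpow_add (abs_pos.2 h)]
    norm_num

lemma powPairing_sub (p : ℝ) (x v w : Vec d) :
    powPairing p x (v - w) = powPairing p x v - powPairing p x w := by
  simp only [powPairing, ← Finset.sum_sub_distrib, PiLp.sub_apply, mul_sub]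

lemma powPairing_smul (p : ℝ) (x v : Vec d) (c : ℝ) :
    powPairing p x (c • v) = c * powPairing p x v := by
  simp only [powPairing, Finset.mul_sum, PiLp.smul_apply, smul_eq_mul]
  exact Finset.sum_congr rfl fun i _ => by ring

lemma continuous_dgf (hp : 1 < p) (hpq : p ≤ q) : Continuous (dgf p q : Vec d → ℝ) :=
  continuous_iff_continuousAt.2 fun x => (differentiableAt_dgf hp hpq x).continuousAt

end Gradient

end StarConvexAcc

namespace StarConvexAcc

/-! ### Convexity inequalities for |·|^p on the line -/

section Scalar

variable {p : ℝ}

lemma abs_rpow_sub_two_mul_of_nonneg (hp : 1 < p) {z : ℝ} (hz : 0 ≤ z) :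
    |z| ^ (p - 2) * z = z ^ (p - 1) := by
  rcases hz.eq_or_lt with rfl | h
  · simp [Real.zero_rpow (by linarith : p - 1 ≠ 0)]
  · rw [abs_of_pos h, ← Real.rpow_add_one h.ne']
    congr 1
    ring

lemma abs_rpow_sub_two_mul_of_nonpos (hp : 1 < p) {z : ℝ} (hz : z ≤ 0) :
    |z| ^ (p - 2) * z = -(-z) ^ (p - 1) := by
  rw [← abs_rpow_sub_two_mul_of_nonneg hp (neg_nonneg.2 hz), abs_neg]
  ring

lemma add_rpow_le_two_rpow_mul (hp : 1 ≤ p) {a b : ℝ} (ha : 0 ≤ a) (hb : 0 ≤ b) :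
    (a + b) ^ p ≤ 2 ^ (p - 1) * (a ^ p + b ^ p) := by
  have := NNReal.rpow_add_le_mul_rpow_add_rpow ⟨a, ha⟩ ⟨b, hb⟩ hp
  exact_mod_cast this

/-- For equal signs, powers with exponent p - 1 ≥ 1 are superadditive, and the constant is not
needed. For opposite signs, convexity of the power gives the factor 2^(2-p), attained at y = -x. -/
lemma two_rpow_two_sub_mul_le (hp : 2 ≤ p) {x y : ℝ} (hxy : x ≤ y) :
    2 ^ (2 - p) * (|y - x| ^ (p - 2) * (y - x)) ≤
      |y| ^ (p - 2) * y - |x| ^ (p - 2) * x := by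
  have hp1 : 1 < p := by linarith
  have hc : (2 : ℝ) ^ (2 - p) ≤ 1 := Real.rpow_le_one_of_one_le_of_nonpos one_le_two (by linarith)
  have hc0 : (0 : ℝ) < 2 ^ (2 - p) := by positivity
  rw [abs_rpow_sub_two_mul_of_nonneg hp1 (sub_nonneg.2 hxy)]
  have hd : 0 ≤ (y - x) ^ (p - 1) := Real.rpow_nonneg (sub_nonneg.2 hxy) _
  rcases le_total 0 x with hx | hx
  · rw [abs_rpow_sub_two_mul_of_nonneg hp1 hx, abs_rpow_sub_two_mul_of_nonneg hp1 (hx.trans hxy)]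
    have := Real.add_rpow_le_rpow_add (p := p - 1) (sub_nonneg.2 hxy) hx (by linarith)
    rw [sub_add_cancel] at this
    nlinarith
  rcases le_total 0 y with hy | hy
  · rw [abs_rpow_sub_two_mul_of_nonneg hp1 hy, abs_rpow_sub_two_mul_of_nonpos hp1 hx]
    have := add_rpow_le_two_rpow_mul (p := p - 1) (by linarith) hy (neg_nonneg.2 hx)
    rw [← sub_eq_add_neg] at this
    have h2 := mul_le_mul_of_nonneg_left this hc0.le
    rw [← mul_assoc, ← Real.rpow_add two_pos, show 2 - p + (p - 1 - 1) = 0 by ring,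
      Real.rpow_zero] at h2
    linarith
  · rw [abs_rpow_sub_two_mul_of_nonpos hp1 hy, abs_rpow_sub_two_mul_of_nonpos hp1 hx]
    have := Real.add_rpow_le_rpow_add (p := p - 1) (sub_nonneg.2 hxy) (neg_nonneg.2 hy)
      (by linarith)
    rw [show y - x + -y = -x by ring] at this
    nlinarith

lemma hasDerivAt_abs_sub_rpow (hp : 1 < p) (x y : ℝ) :
    HasDerivAt (fun z => |z - x| ^ p) (p * |y - x| ^ (p - 2) * (y - x)) y :=
  (hasDerivAt_abs_rpow (y - x) hp).comp_sub_const y x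

/-- The difference of the two sides vanishes at y = x, and its derivative in y is p times the gap in
`two_rpow_two_sub_mul_le`. -/
lemma abs_rpow_bregman_ge_of_le (hp : 2 ≤ p) {x y : ℝ} (hxy : x ≤ y) :
    2 ^ (2 - p) * |y - x| ^ p ≤ |y| ^ p - |x| ^ p - p * (|x| ^ (p - 2) * x * (y - x)) := by
  have hp1 : 1 < p := by linarith
  set f : ℝ → ℝ := fun z => |z| ^ p - |x| ^ p - p * (|x| ^ (p - 2) * x * (z - x)) -
    2 ^ (2 - p) * |z - x| ^ p with hf
  have hder (z : ℝ) : HasDerivAt f (p * |z| ^ (p - 2) * z - p * (|x| ^ (p - 2) * x * 1) -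
      2 ^ (2 - p) * (p * |z - x| ^ (p - 2) * (z - x))) z :=
    (((hasDerivAt_abs_rpow z hp1).sub_const _).sub
      ((((hasDerivAt_id z).sub_const x).const_mul _).const_mul p)).sub
      ((hasDerivAt_abs_sub_rpow hp1 x z).const_mul _)
  have hmono : MonotoneOn f (Set.Ici x) := by
    refine monotoneOn_of_deriv_nonneg (convex_Ici x)
      (fun z _ => (hder z).continuousAt.continuousWithinAt)
      (fun z _ => (hder z).differentiableAt.differentiableWithinAt) fun z hz => ?_
    rw [interior_Ici, Set.mem_Ioi] at hz
    rw [(hder z).deriv]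
    have := mul_le_mul_of_nonneg_left (two_rpow_two_sub_mul_le hp hz.le) (by linarith : 0 ≤ p)
    nlinarith
  have h0 : f x = 0 := by simp [hf, Real.zero_rpow (by linarith : p ≠ 0)]
  have := hmono (Set.mem_Ici.2 le_rfl) (Set.mem_Ici.2 hxy) hxy
  rw [h0] at this
  simp only [hf] at this
  linarith

/-- Uniform convexity of `|·| ^ p` for `p ≥ 2`. -/
lemma abs_rpow_bregman_ge (hp : 2 ≤ p) (x y : ℝ) :
    2 ^ (2 - p) * |y - x| ^ p ≤ |y| ^ p - |x| ^ p - p * (|x| ^ (p - 2) * x * (y - x)) := by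
  rcases le_total x y with h | h
  · exact abs_rpow_bregman_ge_of_le hp h
  · have := abs_rpow_bregman_ge_of_le hp (neg_le_neg h)
    rw [show -y - -x = -(y - x) by ring, abs_neg, abs_neg, abs_neg] at this
    linarith

/-- Monotonicity in y on [0, x]; the sign of the derivative follows from concavity of the power p -
1 (Bernoulli at z / x). -/
lemma rpow_bregman_ge_of_le (hp : 1 < p) (hp2 : p ≤ 2) {x y : ℝ} (hx : 0 < x) (hy : 0 ≤ y)
    (hyx : y ≤ x) :
    (p - 1) / 4 * (y - x) ^ 2 * x ^ (p - 2) ≤ y ^ p - x ^ p - p * (x ^ (p - 1) * (y - x)) := by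
  set f : ℝ → ℝ := fun z => z ^ p - x ^ p - p * (x ^ (p - 1) * (z - x)) -
    (p - 1) / 4 * (z - x) ^ 2 * x ^ (p - 2) with hf
  have hder (z : ℝ) : HasDerivAt f (p * z ^ (p - 1) - p * (x ^ (p - 1) * 1) -
      (p - 1) / 4 * (2 * (z - x) ^ (2 - 1) * 1) * x ^ (p - 2)) z :=
    (((Real.hasDerivAt_rpow_const (Or.inr hp.le)).sub_const _).sub
      ((((hasDerivAt_id z).sub_const x).const_mul _).const_mul p)).sub
      (((((hasDerivAt_id z).sub_const x).pow 2).const_mul _).mul_const _)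
  have hanti : AntitoneOn f (Set.Icc 0 x) := by
    refine antitoneOn_of_deriv_nonpos (convex_Icc 0 x)
      (fun z _ => (hder z).continuousAt.continuousWithinAt)
      (fun z _ => (hder z).differentiableAt.differentiableWithinAt) fun z hz => ?_
    rw [interior_Icc] at hz
    rw [(hder z).deriv]
    have hz0 : 0 < z := hz.1
    have hb : (z / x) ^ (p - 1) ≤ 1 + (p - 1) * (z / x - 1) := by
      have h : -1 ≤ z / x - 1 := by have := div_pos hz0 hx; linarith
      have := rpow_one_add_le_one_add_mul_self h (p := p - 1) (by linarith) (by linarith)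
      rwa [add_sub_cancel] at this
    rw [Real.div_rpow hz0.le hx.le, div_le_iff₀ (by positivity)] at hb
    have hx1 : x ^ (p - 1) = x ^ (p - 2) * x := by
      rw [← Real.rpow_add_one hx.ne']; congr 1; ring
    have h2 : (1 + (p - 1) * (z / x - 1)) * x ^ (p - 1) =
        x ^ (p - 1) + (p - 1) * (z - x) * x ^ (p - 2) := by
      rw [hx1]; field_simp
    rw [h2] at hb
    have hxp : 0 < x ^ (p - 2) := by positivity
    have h3 := mul_le_mul_of_nonneg_left hb (by linarith : 0 ≤ p)
    have h4 : 0 ≤ (p - 1) * (x - z) * x ^ (p - 2) * (p - 1 / 2) := by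
      have : 0 ≤ x - z := by linarith [hz.2]
      have : 0 ≤ p - 1 := by linarith
      have : 0 ≤ p - 1 / 2 := by linarith
      positivity
    norm_num
    nlinarith
  have h0 : f x = 0 := by simp [hf]
  have := hanti ⟨hy, hyx⟩ ⟨hx.le, le_rfl⟩ hyx
  rw [h0] at this
  simp only [hf] at this
  linarith

/-- The base point x is varied instead of y, so that the weight y^(p-2) stays constant; it is
dominated by z^(p-2) for z ≤ y. -/
lemma rpow_bregman_ge_of_ge (hp : 1 < p) (hp2 : p ≤ 2) {x y : ℝ} (hx : 0 < x) (hxy : x ≤ y) :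
    (p - 1) / 4 * (y - x) ^ 2 * y ^ (p - 2) ≤ y ^ p - x ^ p - p * (x ^ (p - 1) * (y - x)) := by
  have hy : 0 < y := hx.trans_le hxy
  set f : ℝ → ℝ := fun z => y ^ p - z ^ p - p * (z ^ (p - 1) * (y - z)) -
    (p - 1) / 4 * (y - z) ^ 2 * y ^ (p - 2) with hf
  have hder (z : ℝ) (hz : 0 < z) : HasDerivAt f (-(p * z ^ (p - 1)) -
      p * ((p - 1) * z ^ (p - 1 - 1) * (y - z) + z ^ (p - 1) * (-1)) -
      (p - 1) / 4 * (2 * (y - z) ^ (2 - 1) * (-1)) * y ^ (p - 2)) z :=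
    (((Real.hasDerivAt_rpow_const (Or.inr hp.le)).const_sub _).sub
      (((Real.hasDerivAt_rpow_const (Or.inl hz.ne')).mul
        ((hasDerivAt_id z).const_sub y)).const_mul p)).sub
      (((((hasDerivAt_id z).const_sub y).pow 2).const_mul _).mul_const _)
  have hanti : AntitoneOn f (Set.Icc x y) := by
    refine antitoneOn_of_deriv_nonpos (convex_Icc x y)
      (fun z hz => (hder z (hx.trans_le hz.1)).continuousAt.continuousWithinAt) ?_ fun z hz => ?_
    · rw [interior_Icc]
      exact fun z hz => (hder z (hx.trans hz.1)).differentiableAt.differentiableWithinAt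
    rw [interior_Icc] at hz
    have hz0 : 0 < z := hx.trans hz.1
    rw [(hder z hz0).deriv]
    have hle : y ^ (p - 2) ≤ z ^ (p - 2) :=
      Real.rpow_le_rpow_of_nonpos hz0 hz.2.le (by linarith)
    have hyp : 0 < y ^ (p - 2) := by positivity
    have h1 : 0 ≤ (p - 1) * (y - z) := mul_nonneg (by linarith) (by linarith [hz.2])
    have h2 : 0 ≤ p * z ^ (p - 2) - y ^ (p - 2) / 2 := by nlinarith
    rw [show p - 1 - 1 = p - 2 by ring]
    norm_num
    nlinarith [mul_nonneg h1 h2]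
  have h0 : f y = 0 := by simp [hf]
  have := hanti ⟨le_rfl, hxy⟩ ⟨hxy, le_rfl⟩ hxy
  rw [h0] at this
  simp only [hf] at this
  linarith

lemma abs_rpow_bregman_ge_of_nonneg (hp : 1 < p) (hp2 : p ≤ 2) {x : ℝ} (hx : 0 ≤ x) (y : ℝ) :
    (p - 1) / 4 * (y - x) ^ 2 * max |x| |y| ^ (p - 2) ≤
      |y| ^ p - |x| ^ p - p * (|x| ^ (p - 2) * x * (y - x)) := by
  have hsq {z : ℝ} (hz : 0 < z) : z ^ 2 * z ^ (p - 2) = z ^ p := by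
    rw [← Real.rpow_natCast, ← Real.rpow_add hz]; congr 1; push_cast; ring
  rw [abs_rpow_sub_two_mul_of_nonneg hp hx, abs_of_nonneg hx]
  rcases hx.eq_or_lt with rfl | hx
  · rw [max_eq_right (abs_nonneg y), sub_zero, ← sq_abs, Real.zero_rpow (by linarith : p ≠ 0),
      Real.zero_rpow (by linarith : p - 1 ≠ 0)]
    rcases eq_or_ne y 0 with rfl | hy
    · simp [Real.zero_rpow (by linarith : p ≠ 0)]
    · rw [mul_assoc, hsq (abs_pos.2 hy)]
      have : 0 ≤ |y| ^ p := by positivity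
      nlinarith
  rcases le_total 0 y with hy | hy
  · rw [abs_of_nonneg hy]
    rcases le_total y x with h | h
    · rw [max_eq_left h]
      exact rpow_bregman_ge_of_le hp hp2 hx hy h
    · rw [max_eq_right h]
      exact rpow_bregman_ge_of_ge hp hp2 hx h
  · rw [abs_of_nonpos hy]
    -- For opposite signs the right side is u^p + (p-1) x^p + p x^(p-1) u, a sum of nonnegative
    -- terms, and no calculus is needed. The factor 1/4 compensates (u + x)² ≤ 4 max(u, x)².
    obtain ⟨u, rfl⟩ : ∃ u, y = -u := ⟨-y, by ring⟩
    have hu : 0 ≤ u := by linarith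
    rw [neg_neg]
    have hxp : x ^ p = x ^ (p - 1) * x := by rw [← Real.rpow_add_one hx.ne']; congr 1; ring
    have hx1 : 0 < x ^ (p - 1) := by positivity
    rcases le_total u x with h | h
    · rw [max_eq_left h]
      have hx2 : x ^ (p - 1) = x ^ (p - 2) * x := by
        rw [← Real.rpow_add_one hx.ne']; congr 1; ring
      have hup : 0 ≤ u ^ p := by positivity
      have h1 : (p - 1) / 4 * (-u - x) ^ 2 * x ^ (p - 2) ≤
          (p - 1) / 2 * (u + x) * x ^ (p - 1) := by
        rw [hx2]
        have : 0 ≤ (p - 1) / 4 * (u + x) * (x - u) * x ^ (p - 2) := by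
          have : 0 ≤ p - 1 := by linarith
          have : 0 ≤ x - u := by linarith
          positivity
        nlinarith
      have h2 : 0 ≤ x ^ (p - 1) * u := by positivity
      have h3 : 0 ≤ x ^ (p - 1) * x := by positivity
      rw [hxp]
      nlinarith [mul_nonneg (sub_nonneg.2 hp.le) h2, mul_nonneg (sub_nonneg.2 hp.le) h3]
    · rw [max_eq_right h]
      have hu0 : 0 < u := hx.trans_le h
      have h1 : (p - 1) / 4 * (-u - x) ^ 2 * u ^ (p - 2) ≤ u ^ p := by
        rw [← hsq hu0]
        have h4 : (p - 1) / 4 * (-u - x) ^ 2 ≤ u ^ 2 := by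
          have : (-u - x) ^ 2 ≤ 4 * u ^ 2 := by nlinarith
          nlinarith [sq_nonneg u]
        exact mul_le_mul_of_nonneg_right h4 (by positivity)
      have h2 : 0 ≤ x ^ (p - 1) * u := by positivity
      have h3 : 0 ≤ x ^ (p - 1) * x := by positivity
      rw [hxp]
      nlinarith [mul_nonneg (sub_nonneg.2 hp.le) h2, mul_nonneg (sub_nonneg.2 hp.le) h3]

/-- Local strong convexity of `|·| ^ p` for `1 < p ≤ 2`. -/
lemma abs_rpow_bregman_ge_max (hp : 1 < p) (hp2 : p ≤ 2) (x y : ℝ) :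
    (p - 1) / 4 * (y - x) ^ 2 * max |x| |y| ^ (p - 2) ≤
      |y| ^ p - |x| ^ p - p * (|x| ^ (p - 2) * x * (y - x)) := by
  rcases le_total 0 x with h | h
  · exact abs_rpow_bregman_ge_of_nonneg hp hp2 h y
  · have := abs_rpow_bregman_ge_of_nonneg hp hp2 (neg_nonneg.2 h) (-y)
    rw [abs_neg, abs_neg, show -y - -x = -(y - x) by ring, neg_sq] at this
    linarith

end Scalar

end StarConvexAcc

namespace StarConvexAcc

/-! ### Uniform convexity of the distance-generating function -/

section UniformConvexity

variable {d : ℕ} {p q : ℝ}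

lemma sum_bregman_eq (p : ℝ) (x y : Vec d) :
    ∑ i, (|y i| ^ p - |x i| ^ p - p * (|x i| ^ (p - 2) * x i * (y i - x i))) =
      ∑ i, |y i| ^ p - ∑ i, |x i| ^ p - p * powPairing p x (y - x) := by
  simp only [powPairing, Finset.sum_sub_distrib, Finset.mul_sum, PiLp.sub_apply]

/-- Uniform convexity of `‖·‖_p ^ p / p` for `p ≥ 2`. -/
theorem bregman_dgf_self_ge (hp : 2 ≤ p) (x y : Vec d) :
    2 ^ (2 - p) / p * lpNorm p (y - x) ^ p ≤ bregman (dgf p p) y x := by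
  have hp0 : 0 < p := by linarith
  rw [bregman, inner_gradient_dgf (by linarith) le_rfl, dgf, dgf, div_self hp0.ne', sub_self,
    Real.rpow_zero, one_mul, lpNorm_rpow_self hp0.ne', lpNorm_rpow_self hp0.ne',
    lpNorm_rpow_self hp0.ne']
  have h : 2 ^ (2 - p) * ∑ i, |(y - x) i| ^ p ≤
      ∑ i, |y i| ^ p - ∑ i, |x i| ^ p - p * powPairing p x (y - x) := by
    rw [← sum_bregman_eq, Finset.mul_sum]
    exact Finset.sum_le_sum fun i _ => abs_rpow_bregman_ge hp (x i) (y i)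
  rw [div_mul_eq_mul_div, div_le_iff₀ hp0]
  calc _ ≤ _ := h
    _ = _ := by field_simp

/-- Reverse Hölder inequality. -/
lemma sum_rpow_le_of_max {ι : Type*} (s : Finset ι) (hp : 0 < p) (hp2 : p ≤ 2) (h M : ι → ℝ)
    (hM : ∀ i ∈ s, |h i| ≤ 2 * M i) {Q : ℝ} (hQ : ∑ i ∈ s, M i ^ p ≤ Q) (hQ0 : 0 < Q) :
    ∑ i ∈ s, |h i| ^ p ≤ (∑ i ∈ s, h i ^ 2 * M i ^ (p - 2)) ^ (p / 2) * Q ^ (1 - p / 2) := by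
  have hM0 (i) (hi : i ∈ s) : 0 ≤ M i := by linarith [hM i hi, abs_nonneg (h i)]
  set S := ∑ i ∈ s, h i ^ 2 * M i ^ (p - 2) with hS
  have hterm (i) (hi : i ∈ s) : 0 ≤ h i ^ 2 * M i ^ (p - 2) :=
    mul_nonneg (sq_nonneg _) (Real.rpow_nonneg (hM0 i hi) _)
  have hS0 : 0 ≤ S := Finset.sum_nonneg hterm
  -- This excludes indices with M i = 0 and h i ≠ 0, at which the weight M i ^ (p - 2) would have
  -- the default value 0 when p < 2.
  have hMpos (i) (hi : i ∈ s) (h0 : h i ≠ 0) : 0 < M i := by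
    linarith [hM i hi, abs_pos.2 h0]
  rcases hS0.eq_or_lt with h0 | hSpos
  · have hz (i) (hi : i ∈ s) : h i = 0 := by
      by_contra hne
      have h1 := (Finset.sum_eq_zero_iff_of_nonneg hterm).1 h0.symm i hi
      have : 0 < h i ^ 2 * M i ^ (p - 2) :=
        mul_pos (by positivity) (Real.rpow_pos_of_pos (hMpos i hi hne) _)
      linarith
    rw [Finset.sum_eq_zero fun i hi => by rw [hz i hi, abs_zero, Real.zero_rpow hp.ne']]
    positivity
  -- Weighted AM-GM for the summands normalised by S and Q; after summation the bracket is at most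
  -- p/2 + (1 - p/2) = 1.
  have hkey (i) (hi : i ∈ s) : |h i| ^ p ≤ S ^ (p / 2) * Q ^ (1 - p / 2) *
      (p / 2 * (h i ^ 2 * M i ^ (p - 2) / S) + (1 - p / 2) * (M i ^ p / Q)) := by
    have hMi := hM0 i hi
    rcases eq_or_ne (h i) 0 with h0 | h0
    · rw [h0, abs_zero, Real.zero_rpow hp.ne']
      have : 0 ≤ 1 - p / 2 := by linarith
      positivity
    have hpos := hMpos i hi h0
    have hag := Real.geom_mean_le_arith_mean2_weighted (w₁ := p / 2) (w₂ := 1 - p / 2)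
      (p₁ := h i ^ 2 * M i ^ (p - 2) / S) (p₂ := M i ^ p / Q) (by positivity) (by linarith)
      (by positivity) (by positivity) (by ring)
    have heq : |h i| ^ p = S ^ (p / 2) * Q ^ (1 - p / 2) *
        ((h i ^ 2 * M i ^ (p - 2) / S) ^ (p / 2) * (M i ^ p / Q) ^ (1 - p / 2)) := by
      rw [Real.div_rpow (by positivity) hS0, Real.div_rpow (by positivity) hQ0.le,
        Real.mul_rpow (by positivity) (by positivity), ← Real.rpow_mul hMi, ← Real.rpow_mul hMi,
        ← sq_abs, ← Real.rpow_natCast, ← Real.rpow_mul (abs_nonneg _)]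
      have h1 : M i ^ ((p - 2) * (p / 2)) * M i ^ (p * (1 - p / 2)) = 1 := by
        rw [← Real.rpow_add hpos, show (p - 2) * (p / 2) + p * (1 - p / 2) = 0 by ring,
          Real.rpow_zero]
      have h2 : ((2 : ℕ) : ℝ) * (p / 2) = p := by push_cast; ring
      rw [h2]
      have hs1 : S ^ (p / 2) ≠ 0 := by positivity
      have hq1 : Q ^ (1 - p / 2) ≠ 0 := by positivity
      generalize M i ^ ((p - 2) * (p / 2)) = a at h1 ⊢
      generalize M i ^ (p * (1 - p / 2)) = b at h1 ⊢
      calc |h i| ^ p = |h i| ^ p * (a * b) := by rw [h1, mul_one]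
        _ = _ := by field_simp
    rw [heq]
    gcongr
  calc ∑ i ∈ s, |h i| ^ p ≤ ∑ i ∈ s, S ^ (p / 2) * Q ^ (1 - p / 2) *
        (p / 2 * (h i ^ 2 * M i ^ (p - 2) / S) + (1 - p / 2) * (M i ^ p / Q)) :=
        Finset.sum_le_sum hkey
    _ = S ^ (p / 2) * Q ^ (1 - p / 2) *
        (p / 2 * (S / S) + (1 - p / 2) * ((∑ i ∈ s, M i ^ p) / Q)) := by
        rw [← Finset.mul_sum, Finset.sum_add_distrib, ← Finset.mul_sum, ← Finset.mul_sum,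
          ← Finset.sum_div, ← Finset.sum_div]
    _ ≤ S ^ (p / 2) * Q ^ (1 - p / 2) * 1 := by
        have h1 : (∑ i ∈ s, M i ^ p) / Q ≤ 1 := (div_le_one hQ0).2 hQ
        rw [div_self hSpos.ne']
        gcongr
        nlinarith
    _ = _ := mul_one _

lemma pow_bregman_ge (hp : 1 < p) (hp2 : p ≤ 2) (x y : Vec d) :
    (p - 1) / 4 * ∑ i, (y i - x i) ^ 2 * max |x i| |y i| ^ (p - 2) ≤
      ∑ i, |y i| ^ p - ∑ i, |x i| ^ p - p * powPairing p x (y - x) := by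
  rw [← sum_bregman_eq, Finset.mul_sum]
  refine Finset.sum_le_sum fun i _ => ?_
  rw [← mul_assoc]
  exact abs_rpow_bregman_ge_max hp hp2 (x i) (y i)

lemma pow_bregman_nonneg (hp : 1 < p) (hp2 : p ≤ 2) (x y : Vec d) :
    0 ≤ ∑ i, |y i| ^ p - ∑ i, |x i| ^ p - p * powPairing p x (y - x) := by
  refine le_trans ?_ (pow_bregman_ge hp hp2 x y)
  refine mul_nonneg (by linarith) (Finset.sum_nonneg fun i _ => mul_nonneg (sq_nonneg _) ?_)
  exact Real.rpow_nonneg ((abs_nonneg _).trans (le_max_left _ _)) _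

/-- Hölder's inequality, obtained from convexity: the Bregman divergence at y rescaled to the norm
of x is nonnegative, and there the two powers cancel. -/
lemma powPairing_le (hp : 1 < p) (hp2 : p ≤ 2) (x y : Vec d) (hx : 0 < lpNorm p x)
    (hy : 0 < lpNorm p y) :
    powPairing p x y ≤ lpNorm p y * lpNorm p x ^ (p - 1) := by
  have hp0 : 0 < p := by linarith
  set A := lpNorm p x
  set s := lpNorm p y
  have h := pow_bregman_nonneg hp hp2 x ((A / s) • y)
  rw [powPairing_sub, powPairing_smul, powPairing_self hp, ← lpNorm_rpow_self hp0.ne',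
    ← lpNorm_rpow_self hp0.ne', lpNorm_smul hp0, abs_of_pos (div_pos hx hy),
    div_mul_cancel₀ _ hy.ne', sub_self, zero_sub, neg_nonneg] at h
  have h1 : A / s * powPairing p x y ≤ A ^ p := by
    by_contra hc
    push Not at hc
    have := mul_pos hp0 (sub_pos.2 hc)
    linarith
  rw [show p = p - 1 + 1 by ring, Real.rpow_add_one hx.ne', sub_add_cancel, div_mul_eq_mul_div,
    div_le_iff₀ hy] at h1
  nlinarith

/-- The weights max(|x i|, |y i|) have p-th power sum at most (1 + 2^p) ‖x‖^p ≤ 5 ‖x‖^p, and the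
reverse Hölder inequality turns the weighted sum of squares into ‖y - x‖². -/
lemma pow_bregman_ge_of_le (hp : 1 < p) (hp2 : p ≤ 2) (x y : Vec d) (hx : 0 < lpNorm p x)
    (hyx : lpNorm p y ≤ 2 * lpNorm p x) :
    (p - 1) / 20 * lpNorm p (y - x) ^ 2 * lpNorm p x ^ (p - 2) ≤
      lpNorm p y ^ p - lpNorm p x ^ p - p * powPairing p x (y - x) := by
  have hp0 : 0 < p := by linarith
  have hb := pow_bregman_ge hp hp2 x y
  rw [← lpNorm_rpow_self hp0.ne', ← lpNorm_rpow_self hp0.ne'] at hb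
  refine le_trans ?_ hb
  set A := lpNorm p x
  have hs0 := lpNorm_nonneg p y
  set S := ∑ i, (y i - x i) ^ 2 * max |x i| |y i| ^ (p - 2)
  have hS0 : 0 ≤ S := Finset.sum_nonneg fun i _ => mul_nonneg (sq_nonneg _)
    (Real.rpow_nonneg ((abs_nonneg _).trans (le_max_left _ _)) _)
  have hM : ∑ i, max |x i| |y i| ^ p ≤ 5 * A ^ p := by
    calc ∑ i, max |x i| |y i| ^ p ≤ ∑ i, (|x i| ^ p + |y i| ^ p) := by
          refine Finset.sum_le_sum fun i _ => ?_
          have h1 : 0 ≤ |x i| ^ p := Real.rpow_nonneg (abs_nonneg _) _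
          have h2 : 0 ≤ |y i| ^ p := Real.rpow_nonneg (abs_nonneg _) _
          rcases max_choice |x i| |y i| with h | h <;> rw [h] <;> linarith
      _ = A ^ p + lpNorm p y ^ p := by
          rw [Finset.sum_add_distrib, lpNorm_rpow_self hp0.ne', lpNorm_rpow_self hp0.ne']
      _ ≤ A ^ p + (2 * A) ^ p := by gcongr
      _ ≤ A ^ p + 4 * A ^ p := by
          rw [Real.mul_rpow two_pos.le hx.le]
          have : (2 : ℝ) ^ p ≤ 2 ^ (2 : ℝ) := Real.rpow_le_rpow_of_exponent_le one_le_two hp2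
          norm_num at this
          gcongr
      _ = _ := by ring
  have hH := sum_rpow_le_of_max Finset.univ hp0 hp2 (fun i => y i - x i)
    (fun i => max |x i| |y i|) (fun i _ => by
      calc |y i - x i| ≤ |y i| + |x i| := abs_sub _ _
        _ ≤ max |x i| |y i| + max |x i| |y i| := add_le_add (le_max_right _ _) (le_max_left _ _)
        _ = _ := by ring) hM (by positivity)
  change ∑ i, |(y - x) i| ^ p ≤ S ^ (p / 2) * (5 * A ^ p) ^ (1 - p / 2) at hH
  rw [← lpNorm_rpow_self hp0.ne'] at hH
  have hn := lpNorm_nonneg p (y - x)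
  have h2 := Real.rpow_le_rpow (Real.rpow_nonneg hn _) hH (by positivity : 0 ≤ 2 / p)
  rw [← Real.rpow_mul hn, Real.mul_rpow (by positivity) (by positivity), ← Real.rpow_mul hS0,
    ← Real.rpow_mul (by positivity), Real.mul_rpow (by positivity) (by positivity),
    ← Real.rpow_mul hx.le, mul_div_cancel₀ _ hp0.ne', show p / 2 * (2 / p) = 1 by field_simp,
    Real.rpow_one, show p * ((1 - p / 2) * (2 / p)) = -(p - 2) by field_simp; ring,
    Real.rpow_neg hx.le] at h2
  have h5 : (5 : ℝ) ^ ((1 - p / 2) * (2 / p)) ≤ 5 := by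
    calc (5 : ℝ) ^ ((1 - p / 2) * (2 / p)) ≤ 5 ^ (1 : ℝ) := by
          refine Real.rpow_le_rpow_of_exponent_le (by norm_num) ?_
          rw [show (1 - p / 2) * (2 / p) = 2 / p - 1 by field_simp]
          have : 2 / p ≤ 2 := by rw [div_le_iff₀ hp0]; linarith
          linarith
      _ = 5 := Real.rpow_one 5
  have hA : 0 < A ^ (p - 2) := by positivity
  have h3 : lpNorm p (y - x) ^ 2 * A ^ (p - 2) ≤ 5 * S := by
    calc lpNorm p (y - x) ^ 2 * A ^ (p - 2)
        ≤ S * (5 ^ ((1 - p / 2) * (2 / p)) * (A ^ (p - 2))⁻¹) * A ^ (p - 2) := by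
          rw [← Real.rpow_natCast (lpNorm p (y - x))]
          push_cast
          gcongr
      _ = S * 5 ^ ((1 - p / 2) * (2 / p)) := by field_simp
      _ ≤ S * 5 := by gcongr
      _ = _ := by ring
  nlinarith

/-- Strong convexity of `‖·‖_p ^ 2 / 2` for `1 < p ≤ 2`. -/
theorem bregman_dgf_two_ge (hp : 1 < p) (hp2 : p ≤ 2) (x y : Vec d) :
    1 / 20 * (p - 1) / 2 * lpNorm p (y - x) ^ (2 : ℝ) ≤ bregman (dgf p 2) y x := by
  have hp0 : 0 < p := by linarith
  rw [bregman, inner_gradient_dgf hp hp2, dgf, dgf, powPairing_sub, powPairing_self hp,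
    ← lpNorm_rpow_self hp0.ne']
  have hA0 := lpNorm_nonneg p x
  have hs0 := lpNorm_nonneg p y
  have hn0 := lpNorm_nonneg p (y - x)
  rcases hA0.eq_or_lt with h0 | hA
  · have hx0 : x = 0 := lpNorm_eq_zero hp0 h0.symm
    have h1 : powPairing p (0 : Vec d) y = 0 := by simp [powPairing]
    rw [hx0, sub_zero, h1, lpNorm_zero hp0, Real.zero_rpow two_ne_zero, Real.zero_rpow hp0.ne']
    have : 0 ≤ lpNorm p y ^ (2 : ℝ) := Real.rpow_nonneg hs0 _
    simp only [sub_self, mul_zero, zero_div, sub_zero]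
    generalize lpNorm p y ^ (2 : ℝ) = N at this ⊢
    nlinarith [mul_nonneg (sub_nonneg.2 hp2) this]
  have htri := lpNorm_sub_le hp.le y x
  rw [← Real.rpow_mul hA0, show p * (2 / p - 1) = 2 - p by field_simp, Real.rpow_two,
    Real.rpow_two, Real.rpow_two]
  set A := lpNorm p x with hAdef
  set s := lpNorm p y with hsdef
  have hAA : A ^ (2 - p) * A ^ p = A ^ 2 := by
    rw [← Real.rpow_add hA, sub_add_cancel, Real.rpow_two]
  -- For ‖y‖ ≤ 2‖x‖ the estimate for p-th powers is rescaled by A^(2-p). For larger y, Hölder alone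
  -- gives a divergence of at least (s - A)² / 2.
  rcases le_total s (2 * A) with hs | hs
  · have hb := pow_bregman_ge_of_le hp hp2 x y hA hs
    rw [powPairing_sub, powPairing_self hp, ← lpNorm_rpow_self hp0.ne', ← hAdef,
      ← hsdef] at hb
    have hA2 : 0 < A ^ (2 - p) := by positivity
    have hb2 := mul_le_mul_of_nonneg_left hb hA2.le
    have hAm : A ^ (2 - p) * A ^ (p - 2) = 1 := by
      rw [← Real.rpow_add hA]; simp
    -- Passes from p-th powers to squares: A^(2-p) (s^p - A^p) ≤ (p/2) (s² - A²).
    have hag := Real.geom_mean_le_arith_mean2_weighted (w₁ := p / 2) (w₂ := 1 - p / 2)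
      (p₁ := s ^ 2) (p₂ := A ^ 2) (by positivity) (by linarith)
      (by positivity) (by positivity) (by ring)
    rw [← Real.rpow_two, ← Real.rpow_two, ← Real.rpow_mul hs0, ← Real.rpow_mul hA0,
      show 2 * (p / 2) = p by ring, show 2 * (1 - p / 2) = 2 - p by ring, Real.rpow_two,
      Real.rpow_two] at hag
    have e1 : A ^ (2 - p) * ((p - 1) / 20 * lpNorm p (y - x) ^ 2 * A ^ (p - 2)) =
        (p - 1) / 20 * lpNorm p (y - x) ^ 2 := by
      linear_combination ((p - 1) / 20 * lpNorm p (y - x) ^ 2) * hAm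
    rw [e1] at hb2
    have h3 : 0 ≤ (p - 1) / 20 * lpNorm p (y - x) ^ 2 * (2 - p) :=
      mul_nonneg (mul_nonneg (by linarith) (sq_nonneg _)) (by linarith)
    set P := powPairing p x y
    have h4 : p * (1 / 20 * (p - 1) / 2 * lpNorm p (y - x) ^ 2) ≤
        p * (s ^ 2 / 2 - A ^ 2 / 2 - A ^ (2 - p) * (P - A ^ p)) := by
      nlinarith
    exact le_of_mul_le_mul_left h4 hp0
  · have hspos : 0 < s := by linarith
    have hP := powPairing_le hp hp2 x y hA hspos
    have hA2 : 0 < A ^ (2 - p) := by positivity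
    have hAm : A ^ (2 - p) * A ^ (p - 1) = A := by
      rw [← Real.rpow_add hA, show 2 - p + (p - 1) = 1 by ring, Real.rpow_one]
    have hP2 := mul_le_mul_of_nonneg_left hP hA2.le
    rw [← hAdef, ← hsdef] at hP2
    have hP3 : A ^ (2 - p) * (s * A ^ (p - 1)) = s * A := by linear_combination s * hAm
    rw [hP3] at hP2
    -- From s ≥ 2A follows s + A ≤ 3(s - A).
    have hn : lpNorm p (y - x) ^ 2 ≤ (3 * (s - A)) ^ 2 := by
      gcongr
      linarith
    nlinarith [sq_nonneg (lpNorm p (y - x))]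

end UniformConvexity

end StarConvexAcc

namespace StarConvexAcc

/-- `dgf p q` is uniformly convex of order `q` with constant `m`, in every dimension. -/
def DgfUniformlyConvex (p q m : ℝ) : Prop :=
  ∀ (d : ℕ) (x y : Vec d), m / q * lpNorm p (y - x) ^ q ≤ bregman (dgf p q) y x

/-! ### Existence and optimality of the mirror and proximal steps -/

section Minimizers

variable {d : ℕ} {p q : ℝ}

/-- Coercivity: a power of order q > 1 beats the linear term, after comparison of the p-norm with
the Euclidean one. The dimension-dependent factor is harmless, since only existence is concluded. -/
lemma exists_forall_le_of_inner_add_rpow_le (hp : 0 < p) (hq : 1 < q) {f : Vec d → ℝ}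
    (hf : Continuous f) (g x : Vec d) {b c : ℝ} (hc : 0 < c)
    (h : ∀ z, inner ℝ g (z - x) + b + c * lpNorm p (z - x) ^ q ≤ f z) :
    ∃ z, ∀ y, f z ≤ f y := by
  refine hf.exists_forall_le ?_
  set K : ℝ := √d + 1
  have hK : 0 < K := by positivity
  have hlow (v : Vec d) : ‖v‖ * (c / K ^ q * ‖v‖ ^ (q - 1) - ‖g‖) + b ≤
      inner ℝ g v + b + c * lpNorm p v ^ q := by
    have h1 : ‖v‖ ≤ K * lpNorm p v :=
      (norm_le_mul_lpNorm hp v).trans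
        (mul_le_mul_of_nonneg_right (by linarith) (lpNorm_nonneg p v))
    have h2 := Real.rpow_le_rpow (norm_nonneg v) h1 (by linarith : 0 ≤ q)
    rw [Real.mul_rpow hK.le (lpNorm_nonneg p v)] at h2
    have h3 : ‖v‖ ^ (q - 1) * ‖v‖ = ‖v‖ ^ q := by
      rcases (norm_nonneg v).eq_or_lt with h0 | h0
      · rw [← h0, mul_zero, Real.zero_rpow (by linarith)]
      · rw [← Real.rpow_add_one h0.ne', sub_add_cancel]
    have h4 : -(‖g‖ * ‖v‖) ≤ inner ℝ g v := (abs_le.1 (abs_real_inner_le_norm g v)).1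
    have h5 : c / K ^ q * ‖v‖ ^ q ≤ c * lpNorm p v ^ q := by
      have hKq : 0 < K ^ q := by positivity
      rw [div_mul_eq_mul_div, div_le_iff₀ hKq]
      nlinarith
    have h6 : ‖v‖ * (c / K ^ q * ‖v‖ ^ (q - 1) - ‖g‖) = c / K ^ q * ‖v‖ ^ q - ‖g‖ * ‖v‖ := by
      rw [← h3]; ring
    linarith
  have hnorm : Filter.Tendsto (fun z : Vec d => ‖z - x‖) (Filter.cocompact _) Filter.atTop :=
    (tendsto_norm_cocompact_atTop (E := Vec d)).comp
      (Homeomorph.subRight x).isClosedEmbedding.tendsto_cocompact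
  have hreal : Filter.Tendsto (fun r : ℝ => r * (c / K ^ q * r ^ (q - 1) - ‖g‖) + b)
      Filter.atTop Filter.atTop := by
    refine Filter.tendsto_atTop_add_const_right _ _
      (Filter.Tendsto.atTop_mul_atTop₀ Filter.tendsto_id ?_)
    have h1 : 0 < c / K ^ q := by positivity
    simpa [sub_eq_add_neg] using Filter.tendsto_atTop_add_const_right _ (-‖g‖)
      ((tendsto_rpow_atTop (by linarith : 0 < q - 1)).const_mul_atTop h1)
  exact Filter.tendsto_atTop_mono (fun z => (hlow (z - x)).trans (h z)) (hreal.comp hnorm)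

lemma exists_mirror_step {m : ℝ} (hp : 1 < p) (hpq : p ≤ q) (hm : 0 < m)
    (huc : DgfUniformlyConvex p q m) (g x : Vec d) :
    ∃ x', ∀ z, inner ℝ g x' + bregman (dgf p q) x' x ≤ inner ℝ g z + bregman (dgf p q) z x := by
  have hq : 1 < q := hp.trans_le hpq
  refine exists_forall_le_of_inner_add_rpow_le (by linarith : 0 < p) hq ?_ g x
    (b := inner ℝ g x) (c := m / q) (by positivity) fun z => ?_
  · have := continuous_dgf (d := d) hp hpq
    unfold bregman
    fun_prop
  · rw [inner_sub_right]
    linarith [huc d x z]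

lemma exists_prox_step {c : ℝ} (hp : 0 < p) (hq : 1 < q) (hc : 0 < c) (g x : Vec d) :
    ∃ x', ∀ z, inner ℝ g x' + c * lpNorm p (x' - x) ^ q ≤
      inner ℝ g z + c * lpNorm p (z - x) ^ q := by
  refine exists_forall_le_of_inner_add_rpow_le hp hq ?_ g x
    (b := inner ℝ g x) hc fun z => ?_
  · have h : Continuous fun z => lpNorm p (z - x) ^ q :=
      ((continuous_lpNorm hp).comp (continuous_id.sub continuous_const)).rpow_const
        fun _ => Or.inr (by linarith)
    fun_prop
  · rw [inner_sub_right]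
    linarith

/-- First-order optimality gives g = ∇ψ(x) - ∇ψ(x'), and the three-point identity of Bregman
divergences does the rest. -/
lemma mirror_step_le (hp : 1 < p) (hpq : p ≤ q) {g x x' : Vec d}
    (h : ∀ z, inner ℝ g x' + bregman (dgf p q) x' x ≤ inner ℝ g z + bregman (dgf p q) z x)
    (z : Vec d) :
    inner ℝ g (x' - z) ≤
      bregman (dgf p q) z x - bregman (dgf p q) z x' - bregman (dgf p q) x' x := by
  set G := gradient (dgf p q) x
  have hψ := (differentiableAt_dgf hp hpq x').hasFDerivAt
  have hd : HasFDerivAt (fun z => inner ℝ g z + bregman (dgf p q) z x)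
      (innerSL ℝ g + (fderiv ℝ (dgf p q) x' - innerSL ℝ G)) x' := by
    have h1 : HasFDerivAt (fun z => innerSL ℝ g z + (dgf p q z - dgf p q x - innerSL ℝ G (z - x)))
        (innerSL ℝ g + (fderiv ℝ (dgf p q) x' - innerSL ℝ G)) x' := by
      refine (innerSL ℝ g).hasFDerivAt.add ((hψ.sub_const _).sub ?_)
      have := (innerSL ℝ G).hasFDerivAt.comp x' ((hasFDerivAt_id x').sub_const x)
      simpa [Function.comp_def] using this
    exact h1
  have h0 := IsLocalMin.hasFDerivAt_eq_zero (Filter.Eventually.of_forall h) hd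
  have h1 := DFunLike.congr_fun h0 (x' - z)
  simp only [add_apply, sub_apply, innerSL_apply_apply, zero_apply] at h1
  rw [← inner_gradient_left] at h1
  have e1 : inner ℝ G (x' - z) = inner ℝ G (x' - x) - inner ℝ G (z - x) := by
    rw [← inner_sub_right]; congr 1; abel
  have e2 : inner ℝ (gradient (dgf p q) x') (x' - z) =
      -inner ℝ (gradient (dgf p q) x') (z - x') := by
    rw [← inner_neg_right, neg_sub]
  simp only [bregman]
  linarith

end Minimizers

/-! ### One iteration: proximal decrease and potential -/

section Step

variable {d : ℕ} {p q μ κ L τ : ℝ}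

/-- Young's inequality for w / u with weights κ / q and 1 - κ / q; the second weight is then
enlarged to 1. The scale u is free and is later tuned to the number of iterations. -/
lemma young_rpow {w u : ℝ} (hw : 0 ≤ w) (hu : 0 < u) (hκ : 0 < κ) (hκq : κ ≤ q) (hL : 0 ≤ L) :
    L / κ * w ^ κ ≤ L * u ^ (κ - q) / q * w ^ q + L * u ^ κ / κ := by
  have hq : 0 < q := hκ.trans_le hκq
  have hag := Real.geom_mean_le_arith_mean2_weighted (w₁ := κ / q) (w₂ := 1 - κ / q)
    (p₁ := (w / u) ^ q) (p₂ := 1) (by positivity) (sub_nonneg.2 ((div_le_one hq).2 hκq))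
    (by positivity) zero_le_one (by ring)
  rw [Real.one_rpow, ← Real.rpow_mul (by positivity), mul_div_cancel₀ _ hq.ne',
    Real.div_rpow hw hu.le, Real.div_rpow hw hu.le, mul_one, mul_one,
    div_le_iff₀ (by positivity)] at hag
  have h1 : u ^ κ = u ^ (κ - q) * u ^ q := by rw [← Real.rpow_add hu]; congr 1; ring
  have huq : 0 < u ^ q := by positivity
  have huk : 0 < u ^ κ := by positivity
  have h2 : w ^ κ ≤ κ / q * u ^ (κ - q) * w ^ q + u ^ κ := by
    calc w ^ κ ≤ (κ / q * (w ^ q / u ^ q) + (1 - κ / q)) * u ^ κ := hag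
      _ ≤ (κ / q * (w ^ q / u ^ q) + 1) * u ^ κ := by
          have : 0 ≤ κ / q := by positivity
          gcongr
          linarith
      _ = κ / q * u ^ (κ - q) * w ^ q + u ^ κ := by
          rw [add_mul, one_mul, h1]
          field_simp
  calc L / κ * w ^ κ ≤ L / κ * (κ / q * u ^ (κ - q) * w ^ q + u ^ κ) := by gcongr
    _ = _ := by field_simp

lemma IsWeaklySmooth.le_add {F : Vec d → ℝ} (hF : IsWeaklySmooth p L κ F) (x y : Vec d) :
    F y ≤ F x + inner ℝ (gradient F x) (y - x) + L / κ * lpNorm p (y - x) ^ κ := by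
  have := (abs_le.1 (hF.bound y x)).2
  rw [bregman] at this
  linarith

lemma IsStarConvexAbout.gradient_eq_zero {F : Vec d → ℝ} {xs : Vec d}
    (hF : IsStarConvexAbout τ F xs) : gradient F xs = 0 := by
  have : fderiv ℝ F xs = 0 := IsLocalMin.fderiv_eq_zero (Filter.Eventually.of_forall hF.isMin)
  rw [gradient, this, map_zero]

lemma sub_min_le {F : Vec d → ℝ} {xs : Vec d} (hS : IsStarConvexAbout τ F xs)
    (hF : IsWeaklySmooth p L κ F) (x : Vec d) :
    F x - F xs ≤ L / κ * lpNorm p (x - xs) ^ κ := by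
  have := hF.le_add xs x
  rw [hS.gradient_eq_zero, inner_zero_left] at this
  linarith

/-- The smoothness constants of the proximal step: the step size `α`, and the error `δ` with which
the weakly smooth function is majorized by a power of order `q`. -/
structure ProxConst (q μ κ L u α δ : ℝ) : Prop where
  one_lt : 1 < κ
  le : κ ≤ q
  L_pos : 0 < L
  μ_pos : 0 < μ
  u_pos : 0 < u
  α_eq : α = μ * u ^ (q - κ) / L
  δ_eq : δ = L * u ^ κ / κ

variable {u α δ : ℝ}

namespace ProxConst

lemma α_pos (h : ProxConst q μ κ L u α δ) : 0 < α := by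
  have := h.L_pos; have := h.μ_pos; have := h.u_pos
  rw [h.α_eq]; positivity

lemma δ_pos (h : ProxConst q μ κ L u α δ) : 0 < δ := by
  have := h.L_pos; have := h.one_lt; have := h.u_pos
  rw [h.δ_eq]; positivity

lemma q_pos (h : ProxConst q μ κ L u α δ) : 0 < q := by
  linarith [h.one_lt, h.le]

lemma le_add (h : ProxConst q μ κ L u α δ) {F : Vec d → ℝ} (hF : IsWeaklySmooth p L κ F)
    (x y : Vec d) :
    F y ≤ F x + inner ℝ (gradient F x) (y - x) + μ / (q * α) * lpNorm p (y - x) ^ q + δ := by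
  have h1 := hF.le_add x y
  have h2 := young_rpow (lpNorm_nonneg p (y - x)) h.u_pos (by linarith [h.one_lt]) h.le
    h.L_pos.le (q := q)
  have h3 : L * u ^ (κ - q) / q = μ / (q * α) := by
    have := h.L_pos; have := h.μ_pos; have := h.u_pos; have := h.q_pos
    rw [h.α_eq, show κ - q = -(q - κ) by ring, Real.rpow_neg h.u_pos.le]
    field_simp
  rw [h3, ← h.δ_eq] at h2
  linarith

/-- Progress of the proximal step. -/
lemma prox_progress (h : ProxConst q μ κ L u α δ) {F : Vec d → ℝ} (hF : IsWeaklySmooth p L κ F)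
    {m a : Vec d}
    (hprox : ∀ z, α * inner ℝ (gradient F m) a + μ / q * lpNorm p (a - m) ^ q ≤
      α * inner ℝ (gradient F m) z + μ / q * lpNorm p (z - m) ^ q) (v : Vec d) :
    -(α * (F m - F a + δ)) ≤ α * inner ℝ (gradient F m) v + μ / q * lpNorm p v ^ q := by
  have h1 := hprox (m + v)
  rw [add_sub_cancel_left, inner_add_right] at h1
  have h2 := mul_le_mul_of_nonneg_left (h.le_add hF m a) h.α_pos.le
  rw [inner_sub_right] at h2
  have h3 : α * (μ / (q * α) * lpNorm p (a - m) ^ q) = μ / q * lpNorm p (a - m) ^ q := by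
    have := h.α_pos; have := h.q_pos
    field_simp
  linarith

/-- The length of the proximal step. -/
lemma prox_length (h : ProxConst q μ κ L u α δ) (hq : 2 ≤ q) (hp : 0 < p) {F : Vec d → ℝ}
    {xs : Vec d} (hS : IsStarConvexAbout τ F xs) (hF : IsWeaklySmooth p L κ F) {m a : Vec d}
    (hprox : ∀ z, α * inner ℝ (gradient F m) a + μ / q * lpNorm p (a - m) ^ q ≤
      α * inner ℝ (gradient F m) z + μ / q * lpNorm p (z - m) ^ q) :
    lpNorm p (a - m) ^ q ≤ 2 * q * u ^ (q - κ) * (lpNorm p (m - xs) ^ κ + u ^ κ) := by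
  have hα := h.α_pos; have hq0 := h.q_pos; have hL := h.L_pos; have hμ := h.μ_pos
  have hu := h.u_pos; have hκ := h.one_lt
  -- Comparison with half the step. As 2^(-q) ≤ 1/4, at least half of the penalty term survives
  -- after the smoothness bound is inserted, and it is bounded by the possible decrease of F.
  have h1 := hprox (m + (2⁻¹ : ℝ) • (a - m))
  rw [add_sub_cancel_left, lpNorm_smul hp, inner_add_right, inner_smul_right, inner_sub_right,
    Real.mul_rpow (abs_nonneg _) (lpNorm_nonneg _ _)] at h1
  have h2 : |(2⁻¹ : ℝ)| ^ q ≤ 1 / 4 := by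
    rw [abs_of_pos (by norm_num)]
    calc (2⁻¹ : ℝ) ^ q ≤ 2⁻¹ ^ (2 : ℝ) :=
          Real.rpow_le_rpow_of_exponent_ge (by norm_num) (by norm_num) hq
      _ = 1 / 4 := by norm_num
  have h3 := mul_le_mul_of_nonneg_left (h.le_add hF m a) hα.le
  rw [inner_sub_right] at h3
  have h4 : α * (μ / (q * α) * lpNorm p (a - m) ^ q) = μ / q * lpNorm p (a - m) ^ q := by
    field_simp
  have h5 := sub_min_le hS hF m
  have h6 := hS.isMin a
  have hw : 0 ≤ lpNorm p (a - m) ^ q := Real.rpow_nonneg (lpNorm_nonneg _ _) _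
  have hρ : 0 ≤ lpNorm p (m - xs) ^ κ := Real.rpow_nonneg (lpNorm_nonneg _ _) _
  have h7 : μ / q * (|(2⁻¹ : ℝ)| ^ q * lpNorm p (a - m) ^ q) ≤
      μ / q * (1 / 4 * lpNorm p (a - m) ^ q) := by gcongr
  have h8 : μ / q * lpNorm p (a - m) ^ q ≤ 2 * (α * (F m - F xs + δ)) := by
    nlinarith [mul_le_mul_of_nonneg_left h6 hα.le]
  have h9 : 2 * (α * (F m - F xs + δ)) ≤
      2 * (α * (L * lpNorm p (m - xs) ^ κ + L * u ^ κ)) := by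
    have e1 : L / κ * lpNorm p (m - xs) ^ κ ≤ L * lpNorm p (m - xs) ^ κ := by
      gcongr
      exact div_le_self hL.le hκ.le
    have e2 : δ ≤ L * u ^ κ := by
      rw [h.δ_eq]
      exact div_le_self (by positivity) hκ.le
    gcongr
    · linarith
  have h10 := h8.trans h9
  rw [h.α_eq, div_mul_eq_mul_div, div_le_iff₀ hq0] at h10
  have h11 : 2 * (μ * u ^ (q - κ) / L * (L * lpNorm p (m - xs) ^ κ + L * u ^ κ)) * q =
      μ * (2 * q * u ^ (q - κ) * (lpNorm p (m - xs) ^ κ + u ^ κ)) := by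
    field_simp
  rw [h11] at h10
  exact le_of_mul_le_mul_left h10 hμ

end ProxConst

/-- One step of the potential function argument. -/
lemma potential_step (h : ProxConst q μ κ L u α δ) (hp : 1 < p) (hpq : p ≤ q) {m : ℝ}
    (huc : DgfUniformlyConvex p q m) (hτ : 0 < τ) {F : Vec d → ℝ} {xs : Vec d}
    (hS : IsStarConvexAbout τ F xs) (hF : IsWeaklySmooth p L κ F) {Γ η e : ℝ} (hΓ : 0 ≤ Γ)
    (hη : 0 < η) (hη2 : η * μ * (τ * η / (Γ + η)) ^ (q - 1) ≤ α * m) {x x' xag xmd xag' : Vec d}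
    (htest : inner ℝ (gradient F xmd) (xmd - x) + Γ / (τ * η) * (F xmd - F xag) ≤ e)
    (hmirror : ∀ z, η * inner ℝ (gradient F xmd) x' + bregman (dgf p q) x' x ≤
        η * inner ℝ (gradient F xmd) z + bregman (dgf p q) z x)
    (hprox : ∀ z, α * inner ℝ (gradient F xmd) xag' + μ / q * lpNorm p (xag' - xmd) ^ q ≤
        α * inner ℝ (gradient F xmd) z + μ / q * lpNorm p (z - xmd) ^ q) :
    (Γ + η) * (F xag' - F xs) + τ * bregman (dgf p q) xs x' ≤
      Γ * (F xag - F xs) + τ * bregman (dgf p q) xs x + η * (τ * e) + (Γ + η) * δ := by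
  have hα := h.α_pos
  have hq0 := h.q_pos
  have hΓη : 0 < Γ + η := by positivity
  set g := gradient F xmd
  set s := τ * η / (Γ + η) with hs
  have hs0 : 0 < s := by positivity
  have hstar := hS.star xmd
  have h1 := mirror_step_le hp hpq (g := η • g) (x := x) (x' := x') (fun z => by
    simpa only [inner_smul_left, RCLike.conj_to_real] using hmirror z) xs
  rw [inner_smul_left, RCLike.conj_to_real] at h1
  have h2 := huc d x x'
  -- The proximal step is compared with the mirror displacement scaled by s = τη/(Γ+η). This s makes
  -- τη/s equal to Γ + η, the new weight of the potential.
  have h3 := h.prox_progress hF hprox (s • (x' - x))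
  rw [inner_smul_right, lpNorm_smul (by linarith), abs_of_pos hs0,
    Real.mul_rpow hs0.le (lpNorm_nonneg _ _)] at h3
  set N := lpNorm p (x' - x) ^ q
  have hN : 0 ≤ N := Real.rpow_nonneg (lpNorm_nonneg _ _) _
  set Δ := F xmd - F xag' + δ
  have hsq : s ^ q = s ^ (q - 1) * s := by rw [← Real.rpow_add_one hs0.ne', sub_add_cancel]
  have h4 : -(η * inner ℝ g (x' - x)) ≤ η / s * Δ + m / q * N := by
    have e1 := mul_le_mul_of_nonneg_left h3 (by positivity : 0 ≤ η / (α * s))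
    have e2 : η / (α * s) * -(α * Δ) = -(η / s * Δ) := by field_simp
    have e3 : η / (α * s) * (α * (s * inner ℝ g (x' - x)) + μ / q * (s ^ q * N)) =
        η * inner ℝ g (x' - x) + (η * μ * s ^ (q - 1)) * (N / (q * α)) := by
      rw [hsq]; field_simp
    have e4 : (η * μ * s ^ (q - 1)) * (N / (q * α)) ≤ α * m * (N / (q * α)) := by gcongr
    have e5 : α * m * (N / (q * α)) = m / q * N := by field_simp
    rw [e2, e3] at e1
    linarith
  -- The three pieces are handled by the search test, the proximal step and the mirror step
  -- respectively.
  have h5 : η * (inner ℝ g (xmd - xs)) = η * inner ℝ g (xmd - x) - η * inner ℝ g (x' - x) +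
      η * inner ℝ g (x' - xs) := by
    simp only [inner_sub_right]; ring
  have h6 := mul_le_mul_of_nonneg_left htest (by positivity : 0 ≤ τ * η)
  have e6 : τ * η * (inner ℝ g (xmd - x) + Γ / (τ * η) * (F xmd - F xag)) =
      τ * η * inner ℝ g (xmd - x) + Γ * (F xmd - F xag) := by field_simp
  rw [e6] at h6
  have h7 : τ * (η / s * Δ) = (Γ + η) * Δ := by
    rw [hs]; field_simp
  have h8 := mul_le_mul_of_nonneg_left hstar hη.le
  have h9 : η * (τ * inner ℝ g (xmd - xs)) = τ * (η * inner ℝ g (xmd - xs)) := by ring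
  rw [h9, h5] at h8
  have h10 : η * inner ℝ g (xmd - x) - η * inner ℝ g (x' - x) + η * inner ℝ g (x' - xs) ≤
      η * inner ℝ g (xmd - x) + η / s * Δ + bregman (dgf p q) xs x - bregman (dgf p q) xs x' := by
    linarith
  have h11 := mul_le_mul_of_nonneg_left h10 hτ.le
  have h12 : (Γ + η) * Δ = (Γ + η) * (F xmd - F xs) - (Γ + η) * (F xag' - F xs) + (Γ + η) * δ := by
    ring
  nlinarith

end Step

end StarConvexAcc

namespace StarConvexAcc

/-! ### Termination and cost of the binary search -/

section Search

variable {d : ℕ} {p L κ : ℝ} {F : Vec d → ℝ} {x xag : Vec d} {C e : ℝ}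

lemma lineFun_one (F : Vec d → ℝ) (x xag : Vec d) : lineFun F x xag 1 = 0 := by
  simp [lineFun]

lemma SearchLoop.searchTest {a b lam : ℝ} {n : ℕ} (h : SearchLoop F x xag C e a b lam n) :
    SearchTest F x xag C e lam := by
  induction h with
  | found a b h => exact h
  | upper a b lam n h hg hrec ih => exact ih
  | lower a b lam n h hg hrec ih => exact ih

lemma BinarySearch.searchTest {lam : ℝ} {n : ℕ} (h : BinarySearch F x xag C e lam n) :
    SearchTest F x xag C e lam := by
  cases h with
  | atOne h1 => simpa [SearchTest, lineFun_one] using h1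
  | atZero h1 h0 => simpa [SearchTest] using h0
  | loop lam n h1 h0 hl => exact hl.searchTest

lemma SearchLoop.mem_Icc {a b lam : ℝ} {n : ℕ} (h : SearchLoop F x xag C e a b lam n)
    (hab : a ≤ b) : lam ∈ Set.Icc a b := by
  induction h with
  | found a b h => constructor <;> linarith
  | upper a b lam n h hg hrec ih =>
    have := ih (by linarith)
    exact ⟨by linarith [this.1], this.2⟩
  | lower a b lam n h hg hrec ih =>
    have := ih (by linarith)
    exact ⟨this.1, by linarith [this.2]⟩

lemma BinarySearch.mem_Icc {lam : ℝ} {n : ℕ} (h : BinarySearch F x xag C e lam n) :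
    lam ∈ Set.Icc (0 : ℝ) 1 := by
  cases h with
  | atOne h1 => exact ⟨zero_le_one, le_rfl⟩
  | atZero h1 h0 => exact ⟨le_rfl, zero_le_one⟩
  | loop lam n h1 h0 hl => exact hl.mem_Icc zero_le_one

lemma SearchTest.inner_le {lam : ℝ} (h : SearchTest F x xag C e lam) {xmd : Vec d}
    (hmd : xmd = lam • xag + (1 - lam) • x) :
    inner ℝ (gradient F xmd) (xmd - x) + C * (F xmd - F xag) ≤ e := by
  have e1 : xmd - x = lam • (xag - x) := by rw [hmd]; module
  rw [e1, inner_smul_right]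
  rw [SearchTest, lineDeriv, lineFun, ← hmd] at h
  exact h

lemma lineFun_sub (F : Vec d → ℝ) (x xag : Vec d) (s t : ℝ) :
    lineFun F x xag s - lineFun F x xag t - (s - t) * lineDeriv F x xag t =
      bregman F (s • xag + (1 - s) • x) (t • xag + (1 - t) • x) := by
  have e1 : s • xag + (1 - s) • x - (t • xag + (1 - t) • x) = (s - t) • (xag - x) := by module
  rw [bregman, e1, inner_smul_right, lineFun, lineFun, lineDeriv]
  ring

lemma IsWeaklySmooth.abs_lineFun_sub_le (hF : IsWeaklySmooth p L κ F) (hp : 0 < p)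
    (x xag : Vec d) (s t : ℝ) :
    |lineFun F x xag s - lineFun F x xag t - (s - t) * lineDeriv F x xag t| ≤
      L / κ * lpNorm p (xag - x) ^ κ * |s - t| ^ κ := by
  have e1 : s • xag + (1 - s) • x - (t • xag + (1 - t) • x) = (s - t) • (xag - x) := by module
  rw [lineFun_sub]
  refine (hF.bound _ _).trans_eq ?_
  rw [e1, lpNorm_smul hp, Real.mul_rpow (abs_nonneg _) (lpNorm_nonneg _ _)]
  ring

lemma hasDerivAt_lineFun (hF : ContDiff ℝ 1 F) (x xag : Vec d) (t : ℝ) :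
    HasDerivAt (lineFun F x xag) (lineDeriv F x xag t) t := by
  have hd := ((hF.differentiable one_ne_zero) (t • xag + (1 - t) • x)).hasFDerivAt
  have hl : HasDerivAt (fun s : ℝ => s • xag + (1 - s) • x) (xag - x) t := by
    have := ((hasDerivAt_id t).smul_const xag).fun_add (((hasDerivAt_id t).const_sub 1).smul_const x)
    simpa [sub_eq_add_neg] using this
  have := (hd.comp_hasDerivAt t hl).sub_const (F xag)
  rw [← inner_gradient_left] at this
  exact this

/-- An interval on which the search is not yet finished contains a critical point with a
nonpositive value. -/
lemma exists_lineDeriv_eq_zero (hF : ContDiff ℝ 1 F) {a b : ℝ} (hab : a < b)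
    (ha : 0 < lineFun F x xag a) (hb : lineFun F x xag b ≤ 0) (hb' : 0 < lineDeriv F x xag b) :
    ∃ t ∈ Set.Icc a b, lineFun F x xag t ≤ 0 ∧ lineDeriv F x xag t = 0 := by
  have hder := hasDerivAt_lineFun hF x xag
  obtain ⟨t, ht, hmin⟩ := isCompact_Icc.exists_isMinOn (Set.nonempty_Icc.2 hab.le)
    (f := lineFun F x xag) (fun s _ => (hder s).continuousAt.continuousWithinAt)
  have htb : lineFun F x xag t ≤ lineFun F x xag b := hmin (Set.right_mem_Icc.2 hab.le)
  have hta : a < t := lt_of_le_of_ne ht.1 fun h => by rw [h] at ha; linarith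
  -- A positive slope at b produces smaller values just to its left, so the minimum over the
  -- interval is interior.
  have htb' : t < b := by
    refine lt_of_le_of_ne ht.2 fun h => ?_
    have hev : ∀ᶠ s in nhdsWithin b (Set.Iio b), lineFun F x xag s < lineFun F x xag b := by
      have hs := (hasDerivAt_iff_tendsto_slope.1 (hder b)).eventually (lt_mem_nhds hb')
      have hs2 := hs.filter_mono (nhdsWithin_mono b (fun s (hs : s < b) => hs.ne))
      filter_upwards [hs2, self_mem_nhdsWithin] with s h1 (h2 : s < b)
      rw [slope_def_field, lt_div_iff_of_neg (by linarith)] at h1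
      linarith
    obtain ⟨s, hs1, hs2, hs3⟩ := (hev.and (Ioo_mem_nhdsLT hab)).exists
    have := hmin (a := s) ⟨hs2.le, hs3.le⟩
    rw [h] at this
    exact absurd hs1 (not_lt.2 this)
  refine ⟨t, ht, htb.trans hb, ?_⟩
  exact (hmin.isLocalMin (Icc_mem_nhds hta htb')).hasDerivAt_eq_zero (hder t)

/-- The stopping test succeeds close to a critical point with a nonpositive value. -/
lemma IsWeaklySmooth.searchTest_of_close (hF : IsWeaklySmooth p L κ F) (hp : 0 < p) (hκ : 1 < κ)
    (hL : 0 < L) (hC : 0 ≤ C) {D h s t : ℝ} (hD : lpNorm p (xag - x) ≤ D)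
    (hs : s ∈ Set.Icc (0 : ℝ) 1) (hst : |s - t| ≤ h) (hh : h ≤ 1)
    (ht : lineFun F x xag t ≤ 0) (ht' : lineDeriv F x xag t = 0)
    (hsmall : (2 + C) * (L / κ * D ^ κ) * h ^ (κ - 1) ≤ e) : SearchTest F x xag C e s := by
  have hD0 : 0 ≤ lpNorm p (xag - x) := lpNorm_nonneg _ _
  have hκ0 : 0 < κ := by linarith
  set H := L / κ * D ^ κ with hH
  have hH0 : 0 ≤ H := by have := hD0.trans hD; positivity
  have hHle : L / κ * lpNorm p (xag - x) ^ κ ≤ H := by rw [hH]; gcongr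
  have h1 := hF.abs_lineFun_sub_le hp x xag s t
  have h2 := hF.abs_lineFun_sub_le hp x xag t s
  rw [ht', mul_zero, sub_zero] at h1
  rw [abs_sub_comm t s] at h2
  have hpow : |s - t| ^ κ = |s - t| ^ (κ - 1) * |s - t| := by
    rcases (abs_nonneg (s - t)).eq_or_lt with h0 | h0
    · rw [← h0, mul_zero, Real.zero_rpow hκ0.ne']
    · rw [← Real.rpow_add_one h0.ne', sub_add_cancel]
  set r := |s - t| with hr
  have hr0 : 0 ≤ r := abs_nonneg _
  have hrk : r ^ (κ - 1) ≤ h ^ (κ - 1) := Real.rpow_le_rpow hr0 hst (by linarith)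
  have hrk0 : 0 ≤ r ^ (κ - 1) := Real.rpow_nonneg hr0 _
  have h3 : L / κ * lpNorm p (xag - x) ^ κ * r ^ κ ≤ H * r ^ κ :=
    mul_le_mul_of_nonneg_right hHle (Real.rpow_nonneg hr0 _)
  have h1' := (abs_le.1 (h1.trans h3)).2
  have h2' := (abs_le.1 (h2.trans h3)).2
  have hgs : lineFun F x xag s ≤ H * h ^ (κ - 1) := by
    have : H * r ^ κ ≤ H * h ^ (κ - 1) := by
      rw [hpow]
      have : r ^ (κ - 1) * r ≤ h ^ (κ - 1) * 1 :=
        mul_le_mul hrk (hst.trans hh) hr0 (hrk0.trans hrk)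
      rw [mul_one] at this
      gcongr
    linarith
  -- Adding the Bregman bounds with base points s and t gives |(s - t) g'(s)| ≤ 2H|s - t|^κ, since
  -- g'(t) = 0; then divide by |s - t|.
  have hds : lineDeriv F x xag s ≤ 2 * (H * h ^ (κ - 1)) := by
    rcases hr0.eq_or_lt with h0 | h0
    · have : s = t := by
        have := abs_eq_zero.1 (hr.symm.trans h0.symm)
        linarith
      rw [this, ht']
      have : 0 ≤ h ^ (κ - 1) := hrk0.trans hrk
      positivity
    · have hprod : (s - t) * lineDeriv F x xag s ≤ 2 * (H * r ^ κ) := by linarith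
      have h1'' := (abs_le.1 (h1.trans h3)).1
      have h2'' := (abs_le.1 (h2.trans h3)).1
      have habs : |(s - t) * lineDeriv F x xag s| ≤ 2 * (H * r ^ κ) :=
        abs_le.2 ⟨by linarith, hprod⟩
      rw [abs_mul, ← hr, hpow] at habs
      have : |lineDeriv F x xag s| ≤ 2 * (H * r ^ (κ - 1)) := by
        refine le_of_mul_le_mul_left ?_ h0
        linarith
      calc lineDeriv F x xag s ≤ _ := le_abs_self _
        _ ≤ _ := this
        _ ≤ _ := by gcongr
  have hh0 : 0 ≤ H * h ^ (κ - 1) := mul_nonneg hH0 (hrk0.trans hrk)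
  rw [SearchTest]
  have h5 : s * lineDeriv F x xag s ≤ 2 * (H * h ^ (κ - 1)) := by
    calc s * lineDeriv F x xag s ≤ s * (2 * (H * h ^ (κ - 1))) :=
          mul_le_mul_of_nonneg_left hds hs.1
      _ ≤ 1 * (2 * (H * h ^ (κ - 1))) := by
          have := hs.2
          gcongr
      _ = _ := one_mul _
  have h6 : C * lineFun F x xag s ≤ C * (H * h ^ (κ - 1)) := mul_le_mul_of_nonneg_left hgs hC
  linarith

/-- Data under which the search loop is analysed. -/
structure SearchState (F : Vec d → ℝ) (x xag : Vec d) (a b : ℝ) : Prop where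
  nonneg : 0 ≤ a
  le_one : b ≤ 1
  lt : a < b
  left : 0 < lineFun F x xag a
  right : lineFun F x xag b ≤ 0
  deriv : 0 < lineDeriv F x xag b

namespace SearchState

variable {a b : ℝ}

lemma upper (h : SearchState F x xag a b) (hg : 0 < lineFun F x xag ((a + b) / 2)) :
    SearchState F x xag ((a + b) / 2) b :=
  ⟨by linarith [h.nonneg, h.lt], h.le_one, by linarith [h.lt], hg, h.right, h.deriv⟩

/-- When g ≤ 0 at the midpoint, a failed test can only be due to the derivative term, so the slope
at the new right end is positive again. -/
lemma lower (h : SearchState F x xag a b) (hC : 0 ≤ C) (he : 0 ≤ e)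
    (ht : ¬ SearchTest F x xag C e ((a + b) / 2)) (hg : ¬ 0 < lineFun F x xag ((a + b) / 2)) :
    SearchState F x xag a ((a + b) / 2) := by
  have h1 := h.nonneg
  have h2 := h.lt
  refine ⟨h1, by linarith [h.le_one], by linarith, h.left, not_lt.1 hg, ?_⟩
  rw [SearchTest, not_le] at ht
  have h3 : C * lineFun F x xag ((a + b) / 2) ≤ 0 :=
    mul_nonpos_of_nonneg_of_nonpos hC (not_lt.1 hg)
  have h4 : 0 < (a + b) / 2 * lineDeriv F x xag ((a + b) / 2) := by linarith
  exact (pos_iff_pos_of_mul_pos h4).1 (by linarith)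

variable {D h : ℝ}

lemma searchTest (hst : SearchState F x xag a b) (hF : IsWeaklySmooth p L κ F) (hp : 0 < p)
    (hκ : 1 < κ) (hL : 0 < L) (hC : 0 ≤ C) (hD : lpNorm p (xag - x) ≤ D)
    (hh : h ≤ 1) (hsmall : (2 + C) * (L / κ * D ^ κ) * h ^ (κ - 1) ≤ e) (hab : b - a ≤ h) :
    SearchTest F x xag C e ((a + b) / 2) := by
  obtain ⟨t, ht, h1, h2⟩ := exists_lineDeriv_eq_zero hF.contDiff hst.lt hst.left hst.right
    hst.deriv
  have := hst.nonneg
  have := hst.le_one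
  have := hst.lt
  refine hF.searchTest_of_close hp hκ hL hC hD ⟨by linarith, by linarith⟩ ?_ hh h1 h2 hsmall
  rw [abs_le]
  constructor <;> linarith [ht.1, ht.2]

/-- The search loop terminates, and it makes at most `3 * (k + 1)` evaluations. -/
lemma exists_searchLoop (hF : IsWeaklySmooth p L κ F) (hp : 0 < p) (hκ : 1 < κ) (hL : 0 < L)
    (hC : 0 ≤ C) (he : 0 ≤ e) (hD : lpNorm p (xag - x) ≤ D) (hh : h ≤ 1)
    (hsmall : (2 + C) * (L / κ * D ^ κ) * h ^ (κ - 1) ≤ e) (k : ℕ) :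
    ∀ {a b : ℝ}, SearchState F x xag a b → b - a ≤ h * 2 ^ k →
      (∃ lam n, SearchLoop F x xag C e a b lam n) ∧
      ∀ lam n, SearchLoop F x xag C e a b lam n → n ≤ 3 * (k + 1) := by
  induction k with
  | zero =>
    intro a b hst hab
    have ht := hst.searchTest hF hp hκ hL hC hD hh hsmall (by simpa using hab)
    refine ⟨⟨_, _, .found a b ht⟩, fun lam n hl => ?_⟩
    cases hl with
    | found _ _ _ => norm_num
    | upper _ _ _ _ h _ _ => exact absurd ht h
    | lower _ _ _ _ h _ _ => exact absurd ht h
  | succ k ih =>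
    intro a b hst hab
    have hpow : h * 2 ^ (k + 1) = 2 * (h * 2 ^ k) := by ring
    rw [hpow] at hab
    refine ⟨?_, fun lam n hl => ?_⟩
    · by_cases ht : SearchTest F x xag C e ((a + b) / 2)
      · exact ⟨_, _, .found a b ht⟩
      by_cases hg : 0 < lineFun F x xag ((a + b) / 2)
      · obtain ⟨lam, n, hl⟩ := (ih (hst.upper hg) (by linarith)).1
        exact ⟨_, _, .upper a b lam n ht hg hl⟩
      · obtain ⟨lam, n, hl⟩ := (ih (hst.lower hC he ht hg) (by linarith)).1
        exact ⟨_, _, .lower a b lam n ht hg hl⟩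
    · cases hl with
      | found _ _ _ => omega
      | upper _ _ _ n ht hg hl =>
        have := (ih (hst.upper hg) (by linarith)).2 _ _ hl
        omega
      | lower _ _ _ n ht hg hl =>
        have := (ih (hst.lower hC he ht hg) (by linarith)).2 _ _ hl
        omega

end SearchState

/-- The binary search terminates, and it makes at most `3 * k + 6` evaluations. -/
theorem exists_binarySearch (hF : IsWeaklySmooth p L κ F) (hp : 0 < p) (hκ : 1 < κ) (hL : 0 < L)
    (hC : 0 ≤ C) (he : 0 < e) {D : ℝ} (hD : lpNorm p (xag - x) ≤ D) {k : ℕ}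
    (hk : (2 + C) * (L / κ * D ^ κ) / e ≤ (2 ^ k) ^ (κ - 1)) :
    (∃ lam n, BinarySearch F x xag C e lam n) ∧
      ∀ lam n, BinarySearch F x xag C e lam n → n ≤ 3 * k + 6 := by
  have hstate (h1 : ¬ lineDeriv F x xag 1 ≤ e) (h0 : ¬ C * lineFun F x xag 0 ≤ e) :
      SearchState F x xag 0 1 := by
    refine ⟨le_rfl, le_rfl, one_pos, ?_, (lineFun_one F x xag).le, by linarith⟩
    have h2 : 0 < C * lineFun F x xag 0 := by linarith
    exact pos_of_mul_pos_right h2 hC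
  have h2k : (0 : ℝ) < 2 ^ k := by positivity
  -- The threshold length is h = 2^(-k): after k halvings of [0, 1] the midpoint must pass the test.
  have hsmall : (2 + C) * (L / κ * D ^ κ) * ((2 ^ k)⁻¹ : ℝ) ^ (κ - 1) ≤ e := by
    rw [Real.inv_rpow h2k.le, ← div_eq_mul_inv, div_le_iff₀ (by positivity)]
    rw [div_le_iff₀ he] at hk
    linarith
  have hloop (h1 : ¬ lineDeriv F x xag 1 ≤ e) (h0 : ¬ C * lineFun F x xag 0 ≤ e) :=
    SearchState.exists_searchLoop hF hp hκ hL hC he.le hD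
      (inv_le_one_of_one_le₀ (one_le_pow₀ one_le_two)) hsmall k (hstate h1 h0)
      (by rw [inv_mul_cancel₀ h2k.ne', sub_zero])
  constructor
  · by_cases h1 : lineDeriv F x xag 1 ≤ e
    · exact ⟨_, _, .atOne h1⟩
    by_cases h0 : C * lineFun F x xag 0 ≤ e
    · exact ⟨_, _, .atZero h1 h0⟩
    obtain ⟨lam, n, hl⟩ := (hloop h1 h0).1
    exact ⟨_, _, .loop lam n h1 h0 hl⟩
  · intro lam n hb
    cases hb with
    | atOne h1 => omega
    | atZero h1 h0 => omega
    | loop lam n h1 h0 hl =>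
      have := (hloop h1 h0).2 _ _ hl
      omega

end Search

end StarConvexAcc

namespace StarConvexAcc

/-! ### Bounds on distances from the star center -/

section Distances

variable {d : ℕ} {p q μ κ L τ u α δ : ℝ}

/-- Add the divergence of the reflected point 2x - y, which is nonnegative: the gradient terms
cancel, and only powers of norms at most 3R remain. -/
lemma bregman_dgf_le {m R : ℝ} (hp : 1 ≤ p) (hq : 2 ≤ q) (hm : 0 ≤ m)
    (huc : DgfUniformlyConvex p q m) {x y : Vec d} (hx : lpNorm p x ≤ R) (hy : lpNorm p y ≤ R) :
    bregman (dgf p q) y x ≤ 3 ^ q * R ^ q := by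
  have hq0 : 0 < q := by linarith
  have hR : 0 ≤ R := (lpNorm_nonneg p x).trans hx
  have h1 := huc d x (x - (y - x))
  have h2 : 0 ≤ m / q * lpNorm p (x - (y - x) - x) ^ q :=
    mul_nonneg (by positivity) (Real.rpow_nonneg (lpNorm_nonneg _ _) _)
  have h3 : lpNorm p (x - (y - x)) ≤ 3 * R := by
    linarith [lpNorm_sub_le hp x (y - x), lpNorm_sub_le hp y x]
  have h4 : lpNorm p (x - (y - x)) ^ q ≤ 3 ^ q * R ^ q := by
    rw [← Real.mul_rpow (by norm_num) hR]
    exact Real.rpow_le_rpow (lpNorm_nonneg _ _) h3 hq0.le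
  have h5 : lpNorm p y ^ q ≤ R ^ q := Real.rpow_le_rpow (lpNorm_nonneg _ _) hy hq0.le
  have h6 : 0 ≤ lpNorm p x ^ q := Real.rpow_nonneg (lpNorm_nonneg _ _) _
  have h7 : R ^ q ≤ 3 ^ q * R ^ q := by
    have : (1 : ℝ) ≤ 3 ^ q := Real.one_le_rpow (by norm_num) hq0.le
    have : 0 ≤ R ^ q := by positivity
    nlinarith
  have h8 : bregman (dgf p q) y x + bregman (dgf p q) (x - (y - x)) x =
      lpNorm p y ^ q / q + lpNorm p (x - (y - x)) ^ q / q - 2 * (lpNorm p x ^ q / q) := by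
    simp only [bregman, dgf, inner_sub_right]
    ring
  have h9 : lpNorm p y ^ q / q + lpNorm p (x - (y - x)) ^ q / q ≤ 3 ^ q * R ^ q := by
    have h10 : 0 ≤ 3 ^ q * R ^ q := by positivity
    rw [← add_div, div_le_iff₀ hq0]
    linarith [mul_le_mul_of_nonneg_left hq h10]
  have h10 : 0 ≤ lpNorm p x ^ q / q := by positivity
  linarith

lemma lpNorm_lineMap_sub_le (hp : 1 ≤ p) {lam ρ : ℝ} (hlam : lam ∈ Set.Icc (0 : ℝ) 1)
    {x y z : Vec d} (hx : lpNorm p (x - z) ≤ ρ) (hy : lpNorm p (y - z) ≤ ρ) :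
    lpNorm p (lam • y + (1 - lam) • x - z) ≤ ρ := by
  have hp0 : 0 < p := by linarith
  have e : lam • y + (1 - lam) • x - z = lam • (y - z) + (1 - lam) • (x - z) := by module
  have h1 := hlam.1
  have h2 : 0 ≤ 1 - lam := by linarith [hlam.2]
  rw [e]
  calc _ ≤ _ := lpNorm_add_le hp _ _
    _ = lam * lpNorm p (y - z) + (1 - lam) * lpNorm p (x - z) := by
        rw [lpNorm_smul hp0, lpNorm_smul hp0, abs_of_nonneg h1, abs_of_nonneg h2]
    _ ≤ lam * ρ + (1 - lam) * ρ := by gcongr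
    _ = ρ := by ring

/-- Polynomial growth of the distance of the proximal iterates from the star center. -/
lemma ProxConst.dist_step (h : ProxConst q μ κ L u α δ) (hκq : κ < q) (hq : 2 ≤ q) (hp : 1 ≤ p)
    {F : Vec d → ℝ} {xs : Vec d} (hS : IsStarConvexAbout τ F xs) (hF : IsWeaklySmooth p L κ F)
    {m a : Vec d}
    (hprox : ∀ z, α * inner ℝ (gradient F m) a + μ / q * lpNorm p (a - m) ^ q ≤
      α * inner ℝ (gradient F m) z + μ / q * lpNorm p (z - m) ^ q) {B s : ℝ} (huB : u ≤ B)
    (hs : 1 ≤ s) (hm : lpNorm p (m - xs) ≤ B * s ^ (q / (q - κ))) :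
    lpNorm p (a - xs) ≤ B * (s + 4 * q) ^ (q / (q - κ)) := by
  have hu := h.u_pos
  have hB : 0 < B := hu.trans_le huB
  have hs0 : 0 < s := by linarith
  have hκ := h.one_lt
  have hqκ : 0 < q - κ := by linarith
  set N := q / (q - κ) with hN
  have hN1 : 1 ≤ N := by rw [hN, one_le_div hqκ]; linarith
  have hlen := h.prox_length hq (by linarith) hS hF hprox
  have hsN : 1 ≤ s ^ N := Real.one_le_rpow hs (by linarith)
  have h1 : lpNorm p (m - xs) ^ κ ≤ (B * s ^ N) ^ κ :=
    Real.rpow_le_rpow (lpNorm_nonneg _ _) hm (by linarith)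
  have h2 : u ^ κ ≤ (B * s ^ N) ^ κ := by
    refine Real.rpow_le_rpow hu.le (huB.trans ?_) (by linarith)
    nlinarith
  have h0 : 0 ≤ lpNorm p (m - xs) ^ κ := Real.rpow_nonneg (lpNorm_nonneg _ _) _
  -- The exponent N = q/(q-κ) solves Nκ = (N-1)q. Thus a point at distance B s^N moves by O(B
  -- s^(N-1)), which is absorbed by raising s by a constant.
  have h3 : lpNorm p (a - m) ^ q ≤ (4 * q * (B * s ^ (N - 1))) ^ q := by
    calc lpNorm p (a - m) ^ q ≤ 2 * q * u ^ (q - κ) * (lpNorm p (m - xs) ^ κ + u ^ κ) := hlen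
      _ ≤ 2 * q * B ^ (q - κ) * ((B * s ^ N) ^ κ + (B * s ^ N) ^ κ) := by gcongr
      _ = 4 * q * (B ^ (q - κ) * B ^ κ * (s ^ N) ^ κ) := by
          rw [Real.mul_rpow hB.le (by positivity)]; ring
      _ = 4 * q * (B ^ q * (s ^ (N - 1)) ^ q) := by
          rw [← Real.rpow_add hB, sub_add_cancel, ← Real.rpow_mul hs0.le, ← Real.rpow_mul hs0.le]
          congr 3
          rw [hN]
          field_simp
          ring
      _ ≤ (4 * q) ^ q * (B ^ q * (s ^ (N - 1)) ^ q) := by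
          gcongr
          calc 4 * q = (4 * q) ^ (1 : ℝ) := (Real.rpow_one _).symm
            _ ≤ (4 * q) ^ q := Real.rpow_le_rpow_of_exponent_le (by linarith) (by linarith)
      _ = _ := by
          rw [← Real.mul_rpow hB.le (by positivity),
            ← Real.mul_rpow (by linarith) (by positivity)]
  have h4 : lpNorm p (a - m) ≤ 4 * q * (B * s ^ (N - 1)) :=
    (Real.rpow_le_rpow_iff (lpNorm_nonneg _ _) (by positivity) (by linarith)).1 h3
  calc lpNorm p (a - xs) ≤ lpNorm p (a - m) + lpNorm p (m - xs) := lpNorm_sub_le_add hp _ _ _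
    _ ≤ 4 * q * (B * s ^ (N - 1)) + B * s ^ N := add_le_add h4 hm
    _ = B * (s ^ (N - 1) * (s + 4 * q)) := by
        have : s ^ N = s ^ (N - 1) * s := by rw [← Real.rpow_add_one hs0.ne', sub_add_cancel]
        rw [this]; ring
    _ ≤ B * ((s + 4 * q) ^ (N - 1) * (s + 4 * q)) := by
        gcongr
        linarith
    _ = _ := by rw [← Real.rpow_add_one (by positivity), sub_add_cancel]

end Distances

/-! ### The step-size schedule -/

section Schedule

/-- The step sizes `γ * ((s + 1) ^ q - s ^ q)` with `s = t - 1`. -/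
noncomputable def stepSize (γ q : ℝ) (s : ℕ) : ℝ :=
  γ * ((s + 1 : ℝ) ^ q - (s : ℝ) ^ q)

/-- The input parameters with constant accuracy and proximal step size, and with mirror step sizes
that sum up to `γ * t ^ q`. -/
noncomputable def accParams (q τ α γ e : ℝ) : Params where
  C t := γ * ((t - 1 : ℕ) : ℝ) ^ q / (τ * stepSize γ q (t - 1))
  eps _ := e
  α _ := α
  η t := stepSize γ q (t - 1)

variable {γ q : ℝ}

lemma stepSize_pos (hγ : 0 < γ) (hq : 0 < q) (s : ℕ) : 0 < stepSize γ q s :=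
  mul_pos hγ (sub_pos.2 (Real.rpow_lt_rpow (by positivity) (by linarith) hq))

/-- Bernoulli's inequality for (1 - 1/(s+1))^q. -/
lemma stepSize_le (hγ : 0 < γ) (hq : 1 ≤ q) (s : ℕ) :
    stepSize γ q s ≤ γ * (q * (s + 1 : ℝ) ^ (q - 1)) := by
  have hs : (0 : ℝ) < s + 1 := by positivity
  refine mul_le_mul_of_nonneg_left ?_ hγ.le
  have h1 : (-1 : ℝ) ≤ -1 / (s + 1) := by
    rw [le_div_iff₀ hs]; linarith [(Nat.cast_nonneg s : (0 : ℝ) ≤ s)]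
  have h2 := one_add_mul_self_le_rpow_one_add h1 hq
  have h3 : (1 : ℝ) + -1 / (s + 1) = s / (s + 1) := by field_simp; ring
  rw [h3, Real.div_rpow (by positivity) hs.le, le_div_iff₀ (by positivity)] at h2
  have h4 : (s + 1 : ℝ) ^ q = (s + 1 : ℝ) ^ (q - 1) * (s + 1) := by
    rw [← Real.rpow_add_one hs.ne', sub_add_cancel]
  have h5 : (1 + q * (-1 / (s + 1))) * (s + 1 : ℝ) ^ q =
      (s + 1 : ℝ) ^ q - q * (s + 1 : ℝ) ^ (q - 1) := by
    rw [h4]; field_simp; ring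
  linarith

/-- Needed to bound the search parameter C linearly in the iteration count. -/
lemma le_stepSize (hγ : 0 < γ) (hq : 1 < q) (s : ℕ) :
    γ * (s : ℝ) ^ q ≤ s * stepSize γ q s := by
  rcases Nat.eq_zero_or_pos s with rfl | hs
  · simp [Real.zero_rpow (by linarith : q ≠ 0)]
  have hs0 : (0 : ℝ) < s := by exact_mod_cast hs
  rw [stepSize]
  have h1 : (s : ℝ) ^ q = (s : ℝ) ^ (q - 1) * s := by
    rw [← Real.rpow_add_one hs0.ne', sub_add_cancel]
  have h2 : (s + 1 : ℝ) ^ q = (s + 1 : ℝ) ^ (q - 1) * (s + 1) := by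
    rw [← Real.rpow_add_one (by positivity), sub_add_cancel]
  have h3 : (s : ℝ) ^ (q - 1) ≤ (s + 1 : ℝ) ^ (q - 1) :=
    Real.rpow_le_rpow hs0.le (by linarith) (by linarith)
  have h4 : (s : ℝ) ^ (q - 1) ≤ (s + 1 : ℝ) ^ q - (s : ℝ) ^ q := by
    rw [h1, h2]; nlinarith
  calc γ * (s : ℝ) ^ q = s * (γ * (s : ℝ) ^ (q - 1)) := by rw [h1]; ring
    _ ≤ _ := by gcongr

lemma add_stepSize (γ q : ℝ) (s : ℕ) :
    γ * (s : ℝ) ^ q + stepSize γ q s = γ * ((s + 1 : ℕ) : ℝ) ^ q := by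
  rw [stepSize]; push_cast; ring

/-- Validity also concerns index 0, which no iteration reads; truncated subtraction makes it a copy
of index 1. -/
lemma accParams_valid {τ α e : ℝ} (hγ : 0 < γ) (hq : 0 < q) (hτ : 0 < τ) (hα : 0 < α)
    (he : 0 < e) : (accParams q τ α γ e).Valid where
  C_nonneg t := by
    have := stepSize_pos hγ hq (t - 1)
    simp only [accParams]; positivity
  eps_pos _ := he
  α_pos _ := hα
  η_pos t := stepSize_pos hγ hq (t - 1)

end Schedule

/-! ### Invariants and cost of a whole run -/

section Run

variable {d : ℕ} {p q μ m κ L τ u α δ γ e B : ℝ} {T k : ℕ}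

/-- The relations between the constants of a run of length `T`: `m` is the constant of uniform
convexity of `dgf p q`, and all mirror iterates stay at distance `B` from the star center. -/
structure RunConst (p q μ m κ L τ u α δ γ e B : ℝ) (T : ℕ) : Prop extends
    ProxConst q μ κ L u α δ where
  one_lt_p : 1 < p
  p_le_q : p ≤ q
  two_le : 2 ≤ q
  lt : κ < q
  m_pos : 0 < m
  τ_pos : 0 < τ
  e_pos : 0 < e
  γ_pos : 0 < γ
  γ_le : γ * q ^ q * τ ^ (q - 1) * μ ≤ α * m
  u_le : u ≤ B
  convex : DgfUniformlyConvex p q m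

namespace RunConst

/-- Here η ≤ γ q (t+1)^(q-1), while τη/Γ_{t+1} ≤ τq/(t+1): the powers of t + 1 cancel, so one
condition on γ serves all iterations. -/
lemma stepSize_cond (h : RunConst p q μ m κ L τ u α δ γ e B T) (t : ℕ) :
    stepSize γ q t * μ * (τ * stepSize γ q t / (γ * (t : ℝ) ^ q + stepSize γ q t)) ^ (q - 1) ≤
      α * m := by
  have hq := h.two_le
  have hτ := h.τ_pos
  have hγ := h.γ_pos
  have hμ := h.μ_pos
  have hη := stepSize_pos hγ (by linarith : 0 < q) t
  have hle := stepSize_le hγ (by linarith : 1 ≤ q) t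
  have ht : (0 : ℝ) < t + 1 := by positivity
  rw [add_stepSize]
  push_cast
  have hq1 : (t + 1 : ℝ) ^ q = (t + 1 : ℝ) ^ (q - 1) * (t + 1) := by
    rw [← Real.rpow_add_one ht.ne', sub_add_cancel]
  have h1 : τ * stepSize γ q t / (γ * (t + 1 : ℝ) ^ q) ≤ τ * q / (t + 1) := by
    rw [div_le_div_iff₀ (by positivity) ht, hq1]
    calc τ * stepSize γ q t * (t + 1) ≤ τ * (γ * (q * (t + 1 : ℝ) ^ (q - 1))) * (t + 1) := by
          gcongr
      _ = _ := by ring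
  calc stepSize γ q t * μ * (τ * stepSize γ q t / (γ * (t + 1 : ℝ) ^ q)) ^ (q - 1)
      ≤ γ * (q * (t + 1 : ℝ) ^ (q - 1)) * μ * (τ * q / (t + 1)) ^ (q - 1) := by
        gcongr
        linarith
    _ = γ * (q ^ (q - 1) * q) * τ ^ (q - 1) * μ := by
        rw [Real.div_rpow (by positivity) ht.le, Real.mul_rpow hτ.le (by linarith)]
        field_simp
    _ = γ * q ^ q * τ ^ (q - 1) * μ := by
        rw [← Real.rpow_add_one (by linarith), sub_add_cancel]
    _ ≤ _ := h.γ_le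

lemma C_le (h : RunConst p q μ m κ L τ u α δ γ e B T) (t : ℕ) :
    (accParams q τ α γ e).C (t + 1) ≤ t / τ := by
  have hη := stepSize_pos h.γ_pos (by linarith [h.two_le] : 0 < q) t
  have hτ := h.τ_pos
  simp only [accParams, Nat.add_sub_cancel]
  rw [div_le_div_iff₀ (by positivity) hτ]
  nlinarith [le_stepSize h.γ_pos (by linarith [h.two_le] : 1 < q) t]

/-- What is known of the iterates after `t` iterations. -/
structure Inv (p q τ γ e δ κ B : ℝ) {d : ℕ} (F : Vec d → ℝ) (xs x1 : Vec d) (t : ℕ)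
    (x xag : Vec d) : Prop where
  potential : γ * (t : ℝ) ^ q * (F xag - F xs) + τ * bregman (dgf p q) xs x ≤
    τ * bregman (dgf p q) xs x1 + γ * (t : ℝ) ^ q * (τ * e + t * δ)
  dist : lpNorm p (x - xs) ≤ B
  dist_ag : lpNorm p (xag - xs) ≤ B * (1 + 4 * q * t) ^ (q / (q - κ))

variable {F : Vec d → ℝ} {xs x1 : Vec d}

/-- Minimality of xs allows the function-value part of the potential to be dropped; uniform
convexity turns the remaining divergence into a distance. -/
lemma dist_le (h : RunConst p q μ m κ L τ u α δ γ e B T) (hS : IsStarConvexAbout τ F xs)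
    (hB : bregman (dgf p q) xs x1 + γ * (T : ℝ) ^ q * (e + T * δ / τ) ≤ m / q * B ^ q)
    {t : ℕ} (ht : t ≤ T) {x xag : Vec d}
    (hpot : γ * (t : ℝ) ^ q * (F xag - F xs) + τ * bregman (dgf p q) xs x ≤
      τ * bregman (dgf p q) xs x1 + γ * (t : ℝ) ^ q * (τ * e + t * δ)) :
    lpNorm p (x - xs) ≤ B := by
  have hτ := h.τ_pos
  have hγ := h.γ_pos
  have hm := h.m_pos
  have hδ := h.δ_pos
  have he := h.e_pos
  have hq0 : 0 < q := by linarith [h.two_le]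
  have hB0 : 0 < B := h.u_pos.trans_le h.u_le
  have htT : (t : ℝ) ≤ T := by exact_mod_cast ht
  have h1 : 0 ≤ γ * (t : ℝ) ^ q * (F xag - F xs) :=
    mul_nonneg (by positivity) (by linarith [hS.isMin xag])
  have h2 : γ * (t : ℝ) ^ q * (τ * e + t * δ) ≤ γ * (T : ℝ) ^ q * (τ * e + T * δ) := by gcongr
  have h3 : γ * (T : ℝ) ^ q * (τ * e + T * δ) = τ * (γ * (T : ℝ) ^ q * (e + T * δ / τ)) := by
    field_simp
  have h4 : bregman (dgf p q) xs x ≤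
      bregman (dgf p q) xs x1 + γ * (T : ℝ) ^ q * (e + T * δ / τ) := by
    refine le_of_mul_le_mul_left ?_ hτ
    linarith
  have h5 := (h.convex d x xs).trans (h4.trans hB)
  have h6 := le_of_mul_le_mul_left h5 (by positivity)
  rw [lpNorm_sub_comm (by linarith [h.one_lt_p])] at h6
  exact (Real.rpow_le_rpow_iff (lpNorm_nonneg _ _) hB0.le hq0).1 h6

lemma inv_zero (h : RunConst p q μ m κ L τ u α δ γ e B T) (hx1 : lpNorm p (x1 - xs) ≤ B) :
    Inv p q τ γ e δ κ B F xs x1 0 x1 x1 := by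
  have hq0 : 0 < q := by linarith [h.two_le]
  exact ⟨by simp [Real.zero_rpow hq0.ne'], hx1, by simpa using hx1⟩

lemma inv_succ (h : RunConst p q μ m κ L τ u α δ γ e B T) (hS : IsStarConvexAbout τ F xs)
    (hF : IsWeaklySmooth p L κ F)
    (hB : bregman (dgf p q) xs x1 + γ * (T : ℝ) ^ q * (e + T * δ / τ) ≤ m / q * B ^ q)
    {t n : ℕ} (ht : t + 1 ≤ T) {x xag xmd x' xag' : Vec d} {lam : ℝ}
    (hinv : Inv p q τ γ e δ κ B F xs x1 t x xag)
    (hsearch : BinarySearch F x xag ((accParams q τ α γ e).C (t + 1)) e lam n)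
    (hmd : xmd = lam • xag + (1 - lam) • x)
    (hmirror : ∀ z, stepSize γ q t * inner ℝ (gradient F xmd) x' + bregman (dgf p q) x' x ≤
        stepSize γ q t * inner ℝ (gradient F xmd) z + bregman (dgf p q) z x)
    (hprox : ∀ z, α * inner ℝ (gradient F xmd) xag' + μ / q * lpNorm p (xag' - xmd) ^ q ≤
        α * inner ℝ (gradient F xmd) z + μ / q * lpNorm p (z - xmd) ^ q) :
    Inv p q τ γ e δ κ B F xs x1 (t + 1) x' xag' := by
  have hq0 : 0 < q := by linarith [h.two_le]
  have hγ := h.γ_pos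
  have hδ := h.δ_pos
  have hτ := h.τ_pos
  have he := h.e_pos
  have hp := h.one_lt_p
  have hB0 : 0 < B := h.u_pos.trans_le h.u_le
  have hη := stepSize_pos hγ hq0 t
  have htest := hsearch.searchTest.inner_le hmd
  simp only [accParams, Nat.add_sub_cancel] at htest
  have hstep := potential_step h.toProxConst hp h.p_le_q h.convex hτ hS hF
    (by positivity : 0 ≤ γ * (t : ℝ) ^ q) hη (h.stepSize_cond t) htest hmirror hprox
  have hadd := add_stepSize γ q t
  rw [hadd] at hstep
  have hpot : γ * ((t + 1 : ℕ) : ℝ) ^ q * (F xag' - F xs) + τ * bregman (dgf p q) xs x' ≤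
      τ * bregman (dgf p q) xs x1 +
        γ * ((t + 1 : ℕ) : ℝ) ^ q * (τ * e + (t + 1 : ℕ) * δ) := by
    have h1 := hinv.potential
    -- The earlier errors δ are charged at the current, larger weight, so their sum becomes Γ_{t+1}
    -- (t+1) δ.
    have h2 : γ * (t : ℝ) ^ q * (t * δ) ≤ γ * ((t + 1 : ℕ) : ℝ) ^ q * (t * δ) := by
      have : γ * (t : ℝ) ^ q ≤ γ * ((t + 1 : ℕ) : ℝ) ^ q := by linarith
      gcongr
    have h3 : γ * ((t + 1 : ℕ) : ℝ) ^ q * (τ * e + (t + 1 : ℕ) * δ) =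
        γ * (t : ℝ) ^ q * (τ * e) + stepSize γ q t * (τ * e) +
          γ * ((t + 1 : ℕ) : ℝ) ^ q * (t * δ) + γ * ((t + 1 : ℕ) : ℝ) ^ q * δ := by
      rw [← hadd]; push_cast; ring
    rw [h3]
    linarith
  refine ⟨hpot, h.dist_le hS hB ht hpot, ?_⟩
  have hs : (1 : ℝ) ≤ 1 + 4 * q * t := by
    have : 0 ≤ 4 * q * t := by positivity
    linarith
  have hBs : B ≤ B * (1 + 4 * q * t) ^ (q / (q - κ)) := by
    have h1 : (1 : ℝ) ≤ (1 + 4 * q * t) ^ (q / (q - κ)) :=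
      Real.one_le_rpow hs (div_nonneg hq0.le (by linarith [h.lt]))
    nlinarith
  have hmdist := lpNorm_lineMap_sub_le hp.le hsearch.mem_Icc (hinv.dist.trans hBs) hinv.dist_ag
  rw [← hmd] at hmdist
  have := h.dist_step h.lt h.two_le hp.le hS hF hprox h.u_le hs hmdist
  convert this using 3
  push_cast
  ring

lemma inv_search (h : RunConst p q μ m κ L τ u α δ γ e B T) (hF : IsWeaklySmooth p L κ F)
    (hk : (2 + T / τ) * (L / κ * (2 * (B * (1 + 4 * q * T) ^ (q / (q - κ)))) ^ κ) / e ≤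
      (2 ^ k) ^ (κ - 1)) {t : ℕ} (ht : t ≤ T) {x xag : Vec d}
    (hinv : Inv p q τ γ e δ κ B F xs x1 t x xag) :
    (∃ lam n, BinarySearch F x xag ((accParams q τ α γ e).C (t + 1)) e lam n) ∧
      ∀ lam n, BinarySearch F x xag ((accParams q τ α γ e).C (t + 1)) e lam n →
        n ≤ 3 * k + 6 := by
  have hq0 : 0 < q := by linarith [h.two_le]
  have hp := h.one_lt_p
  have hL := h.L_pos
  have hκ := h.one_lt
  have hτ := h.τ_pos
  have he := h.e_pos
  have hB0 : 0 < B := h.u_pos.trans_le h.u_le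
  have htT : (t : ℝ) ≤ T := by exact_mod_cast ht
  have hN : 0 ≤ q / (q - κ) := div_nonneg hq0.le (by linarith [h.lt])
  have hC := (accParams_valid h.γ_pos hq0 hτ h.α_pos he).C_nonneg (t + 1)
  have hC2 : (accParams q τ α γ e).C (t + 1) ≤ T / τ := (h.C_le t).trans (by gcongr)
  refine exists_binarySearch hF (by linarith) hκ hL hC he
    (D := 2 * (B * (1 + 4 * q * T) ^ (q / (q - κ)))) ?_ (le_trans ?_ hk)
  · have h1 : (1 : ℝ) ≤ (1 + 4 * q * T) ^ (q / (q - κ)) :=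
      Real.one_le_rpow (by have : 0 ≤ 4 * q * T := by positivity
                           linarith) hN
    have h2 : lpNorm p (xag - xs) ≤ B * (1 + 4 * q * T) ^ (q / (q - κ)) :=
      hinv.dist_ag.trans (by gcongr)
    have h3 := lpNorm_sub_le_add hp.le xag xs x
    rw [lpNorm_sub_comm (by linarith) xs x] at h3
    nlinarith [hinv.dist]
  · gcongr

/-- The method runs for `T` iterations, and the cost of a run is bounded. -/
theorem exists_run (h : RunConst p q μ m κ L τ u α δ γ e B T) (hS : IsStarConvexAbout τ F xs)
    (hF : IsWeaklySmooth p L κ F)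
    (hx1 : lpNorm p (x1 - xs) ≤ B)
    (hB : bregman (dgf p q) xs x1 + γ * (T : ℝ) ^ q * (e + T * δ / τ) ≤ m / q * B ^ q)
    (hk : (2 + T / τ) * (L / κ * (2 * (B * (1 + 4 * q * T) ^ (q / (q - κ)))) ^ κ) / e ≤
      (2 ^ k) ^ (κ - 1)) (t : ℕ) (ht : t ≤ T) :
    (∃ x xag n, Run p q μ (accParams q τ α γ e) F x1 t x xag n) ∧
      ∀ x xag n, Run p q μ (accParams q τ α γ e) F x1 t x xag n →
        Inv p q τ γ e δ κ B F xs x1 t x xag ∧ n ≤ t * (3 * k + 8) := by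
  induction t with
  | zero =>
    refine ⟨⟨_, _, _, .init⟩, fun x xag n hr => ?_⟩
    cases hr
    exact ⟨h.inv_zero hx1, by omega⟩
  | succ t ih =>
    obtain ⟨⟨x, xag, n, hr⟩, hall⟩ := ih (by omega)
    have hq0 : 0 < q := by linarith [h.two_le]
    have hp := h.one_lt_p
    constructor
    · obtain ⟨lam, j, hsearch⟩ := (h.inv_search hF hk (by omega) (hall _ _ _ hr).1).1
      set xmd := lam • xag + (1 - lam) • x with hmd
      obtain ⟨x', hx'⟩ := exists_mirror_step hp h.p_le_q h.m_pos h.convex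
        (stepSize γ q t • gradient F xmd) x
      have hμ : 0 < μ / q := div_pos h.μ_pos hq0
      obtain ⟨xag', hxag'⟩ := exists_prox_step (by linarith : 0 < p)
        (by linarith [h.two_le] : 1 < q) hμ (α • gradient F xmd) xmd
      simp only [inner_smul_left, RCLike.conj_to_real] at hx' hxag'
      exact ⟨x', xag', _, .step t x xag n lam j xmd x' xag' hr hsearch hmd hx' hxag'⟩
    · intro x' xag' n' hr'
      cases hr' with
      | step _ x xag n lam j xmd _ _ hprev hsearch hmd hmirror hprox =>
        obtain ⟨hinv, hn⟩ := hall _ _ _ hprev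
        refine ⟨h.inv_succ hS hF hB ht hinv hsearch hmd hmirror hprox, ?_⟩
        have := (h.inv_search hF hk (by omega) hinv).2 _ _ hsearch
        have e1 : (t + 1) * (3 * k + 8) = t * (3 * k + 8) + (3 * k + 8) := by ring
        omega

end RunConst

end Run

end StarConvexAcc

namespace StarConvexAcc

/-! ### Problems that need no iteration -/

section Trivial

variable {d : ℕ} {p q μ κ L τ R ε : ℝ}

/-- A weakly smooth function which is star-convex with a small constant is constant. -/
lemma eq_of_mul_lt_one (hp : 0 < p) (hτ : 0 < τ) (hτκ : τ * κ < 1)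
    {F : Vec d → ℝ} {xs : Vec d} (hS : IsStarConvexAbout τ F xs) (hF : IsWeaklySmooth p L κ F)
    (x : Vec d) : F x ≤ F xs := by
  set h : ℝ → ℝ := fun s => lineFun F xs x s + (F x - F xs) with hh
  have hder (s : ℝ) : HasDerivAt h (lineDeriv F xs x s) s :=
    (hasDerivAt_lineFun hS.contDiff xs x s).add_const _
  have hpt (s : ℝ) : s • x + (1 - s) • xs - xs = s • (x - xs) := by module
  have hval (s : ℝ) : h s = F (s • x + (1 - s) • xs) - F xs := by
    simp only [hh, lineFun]; ring
  have hstar (s : ℝ) : h s ≤ τ * (s * lineDeriv F xs x s) := by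
    have := hS.star (s • x + (1 - s) • xs)
    rw [hpt, inner_smul_right] at this
    rw [hval]
    exact this
  have hgrow (s : ℝ) (hs : 0 < s) : h s ≤ L / κ * lpNorm p (x - xs) ^ κ * s ^ κ := by
    have := sub_min_le hS hF (s • x + (1 - s) • xs)
    rw [hpt, lpNorm_smul hp, abs_of_pos hs, Real.mul_rpow hs.le (lpNorm_nonneg _ _)] at this
    rw [hval]
    linarith
  -- On the ray from xs through x, star convexity reads h ≤ τ s h', so h grows at least like
  -- s^(1/τ). Weak smoothness allows only s^κ, and κ < 1/τ.
  have hmono : MonotoneOn (fun s => h s * s ^ (-(1 / τ))) (Set.Ici 1) := by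
    have hd (s : ℝ) (hs : 0 < s) : HasDerivAt (fun s => h s * s ^ (-(1 / τ)))
        (lineDeriv F xs x s * s ^ (-(1 / τ)) + h s * (-(1 / τ) * s ^ (-(1 / τ) - 1))) s :=
      (hder s).mul (Real.hasDerivAt_rpow_const (Or.inl hs.ne'))
    refine monotoneOn_of_deriv_nonneg (convex_Ici 1)
      (fun s hs => (hd s (zero_lt_one.trans_le hs)).continuousAt.continuousWithinAt) ?_ ?_
    · rw [interior_Ici]
      exact fun s hs => (hd s (zero_lt_one.trans hs)).differentiableAt.differentiableWithinAt
    · rw [interior_Ici]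
      intro s hs
      have hs0 : 0 < s := zero_lt_one.trans hs
      rw [(hd s hs0).deriv]
      have e1 : s ^ (-(1 / τ)) = s ^ (-(1 / τ) - 1) * s := by
        rw [← Real.rpow_add_one hs0.ne', sub_add_cancel]
      have e2 : lineDeriv F xs x s * s ^ (-(1 / τ)) + h s * (-(1 / τ) * s ^ (-(1 / τ) - 1)) =
          s ^ (-(1 / τ) - 1) / τ * (τ * (s * lineDeriv F xs x s) - h s) := by
        rw [e1]; field_simp; ring
      rw [e2]
      exact mul_nonneg (by positivity) (sub_nonneg.2 (hstar s))
  have hlim : Filter.Tendsto (fun s : ℝ => L / κ * lpNorm p (x - xs) ^ κ * s ^ (-(1 / τ - κ)))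
      Filter.atTop (nhds 0) := by
    have : 0 < 1 / τ - κ := by
      rw [sub_pos, lt_div_iff₀ hτ]; linarith
    simpa using (tendsto_rpow_neg_atTop this).const_mul (L / κ * lpNorm p (x - xs) ^ κ)
  have h1 : h 1 ≤ 0 := by
    refine ge_of_tendsto hlim ?_
    filter_upwards [Filter.eventually_ge_atTop 1] with s hs
    have hs0 : 0 < s := by linarith
    have h2 := hmono (Set.mem_Ici.2 le_rfl) (Set.mem_Ici.2 hs) hs
    simp only [Real.one_rpow, mul_one] at h2
    calc h 1 ≤ h s * s ^ (-(1 / τ)) := h2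
      _ ≤ L / κ * lpNorm p (x - xs) ^ κ * s ^ κ * s ^ (-(1 / τ)) :=
          mul_le_mul_of_nonneg_right (hgrow s hs0) (by positivity)
      _ = _ := by
          rw [mul_assoc, ← Real.rpow_add hs0]
          congr 2
          ring
  rw [hval] at h1
  simpa using h1

lemma SolvesWithin.mono {P : Params} {T : ℕ} {N N' : ℝ}
    (h : SolvesWithin p q μ κ L τ R ε P T N) (hN : N ≤ N') :
    SolvesWithin p q μ κ L τ R ε P T N' := by
  intro d F x1 xs hS hF h1 h2
  obtain ⟨hex, hall⟩ := h d F x1 xs hS hF h1 h2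
  exact ⟨hex, fun y n hr => ⟨(hall y n hr).1, (hall y n hr).2.trans hN⟩⟩

/-- Without any iteration the method returns the starting point. -/
lemma solvesWithin_zero (P : Params) {N : ℝ} (hN : 0 ≤ N)
    (h : ∀ (d : ℕ) (F : Vec d → ℝ) (x1 xs : Vec d), IsStarConvexAbout τ F xs →
      IsWeaklySmooth p L κ F → lpNorm p x1 ≤ R → lpNorm p xs ≤ R → F x1 ≤ F xs + ε) :
    SolvesWithin p q μ κ L τ R ε P 0 N := by
  intro d F x1 xs hS hF h1 h2
  refine ⟨⟨x1, 0, x1, .init⟩, fun y n hr => ?_⟩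
  obtain ⟨x, hr⟩ := hr
  cases hr
  exact ⟨h d F x1 xs hS hF h1 h2, by simpa using hN⟩

end Trivial

/-! ### Choice of constants -/

section Constants

/-- Take k as the base-2 logarithm of (K Z^n)^(1/a), rounded up; Z ≥ 2 lets all additive constants
be absorbed into log Z. -/
lemma exists_nat_rpow_ge {K n a : ℝ} (hK : 1 ≤ K) (hn : 0 ≤ n) (ha : 0 < a) :
    ∃ K' : ℝ, 0 ≤ K' ∧ ∀ Z : ℝ, 2 ≤ Z →
      ∃ k : ℕ, K * Z ^ n ≤ ((2 : ℝ) ^ k) ^ a ∧ (k : ℝ) ≤ K' * Real.log Z := by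
  have hl2 : 0 < Real.log 2 := Real.log_pos one_lt_two
  have hlK : 0 ≤ Real.log K := Real.log_nonneg hK
  refine ⟨(Real.log K / Real.log 2 + n) / (a * Real.log 2) + 1 / Real.log 2, by positivity,
    fun Z hZ => ?_⟩
  have hZ0 : 0 < Z := by linarith
  have hlZ : Real.log 2 ≤ Real.log Z := Real.log_le_log two_pos hZ
  have hlZ0 : 0 < Real.log Z := hl2.trans_le hlZ
  set k := ⌈(Real.log K + n * Real.log Z) / (a * Real.log 2)⌉₊
  refine ⟨k, ?_, ?_⟩
  · have h1 : (Real.log K + n * Real.log Z) / (a * Real.log 2) ≤ k := Nat.le_ceil _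
    rw [div_le_iff₀ (by positivity)] at h1
    rw [← Real.log_le_log_iff (by positivity) (by positivity), Real.log_mul (by positivity)
      (by positivity), Real.log_rpow hZ0, Real.log_rpow (by positivity), Real.log_pow]
    linarith
  · have h1 : (k : ℝ) < (Real.log K + n * Real.log Z) / (a * Real.log 2) + 1 :=
      Nat.ceil_lt_add_one (by positivity)
    have h2 : Real.log K ≤ Real.log K / Real.log 2 * Real.log Z := by
      rw [div_mul_eq_mul_div, le_div_iff₀ hl2]
      gcongr
    have h3 : 1 ≤ 1 / Real.log 2 * Real.log Z := by
      rw [one_div_mul_eq_div, one_le_div hl2]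
      exact hlZ
    calc (k : ℝ) ≤ (Real.log K + n * Real.log Z) / (a * Real.log 2) + 1 := h1.le
      _ ≤ (Real.log K / Real.log 2 * Real.log Z + n * Real.log Z) / (a * Real.log 2) +
          1 / Real.log 2 * Real.log Z := by gcongr
      _ = _ := by ring

/-- The hypotheses under which the method has to iterate, with `r = R / μ ^ (1 / q)`. -/
structure Nontrivial (q μ c κ L τ R ε r : ℝ) : Prop where
  two_le : 2 ≤ q
  one_lt : 1 < κ
  le_two : κ ≤ 2
  lt : κ < q
  c_pos : 0 < c
  c_le : c ≤ 1
  μ_pos : 0 < μ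
  μ_le : μ ≤ 1
  L_pos : 0 < L
  R_pos : 0 < R
  ε_pos : 0 < ε
  τ_ge : 1 / 2 ≤ τ
  ε_le : ε ≤ 4 * (L * R ^ κ)
  r_eq : r = R / μ ^ (1 / q)

namespace Nontrivial

variable {q μ c κ L τ R ε r : ℝ}

lemma r_pos (h : Nontrivial q μ c κ L τ R ε r) : 0 < r := by
  have := h.R_pos; have := h.μ_pos
  rw [h.r_eq]; positivity

lemma R_le_r (h : Nontrivial q μ c κ L τ R ε r) : R ≤ r := by
  have := h.μ_pos
  rw [h.r_eq, le_div_iff₀ (by positivity)]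
  have : μ ^ (1 / q) ≤ 1 :=
    Real.rpow_le_one h.μ_pos.le h.μ_le (one_div_nonneg.2 (by linarith [h.two_le]))
  nlinarith [h.R_pos]

lemma r_rpow (h : Nontrivial q μ c κ L τ R ε r) : r ^ q = R ^ q / μ := by
  have hq : q ≠ 0 := by linarith [h.two_le]
  rw [h.r_eq, Real.div_rpow h.R_pos.le (Real.rpow_nonneg h.μ_pos.le _), ← Real.rpow_mul h.μ_pos.le,
    one_div_mul_cancel hq, Real.rpow_one]

lemma one_le_two_τ_rpow (h : Nontrivial q μ c κ L τ R ε r) {s : ℝ} (hs : 0 ≤ s) :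
    1 ≤ 2 ^ s * τ ^ s := by
  rw [← Real.mul_rpow two_pos.le (by linarith [h.τ_ge])]
  exact Real.one_le_rpow (by linarith [h.τ_ge]) hs

/-- Since 2τ ≥ 1, raising the exponent of τ to q costs only a constant, so that τ can enter all
bounds through X. -/
lemma τ_rpow_le (h : Nontrivial q μ c κ L τ R ε r) {s : ℝ} (hs : 0 ≤ s) (hsq : s ≤ q) :
    τ ^ s ≤ 2 ^ q * τ ^ q := by
  have hτ : 0 < τ := by linarith [h.τ_ge]
  have h1 := h.one_le_two_τ_rpow (s := q - s) (by linarith)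
  have h2 : (2 : ℝ) ^ (q - s) ≤ 2 ^ q :=
    Real.rpow_le_rpow_of_exponent_le one_le_two (by linarith)
  have h3 : τ ^ q = τ ^ (q - s) * τ ^ s := by rw [← Real.rpow_add hτ, sub_add_cancel]
  have h4 : 0 < τ ^ s := by positivity
  have h5 : 0 < τ ^ (q - s) := by positivity
  calc τ ^ s = 1 * τ ^ s := (one_mul _).symm
    _ ≤ 2 ^ (q - s) * τ ^ (q - s) * τ ^ s := by gcongr
    _ ≤ 2 ^ q * τ ^ (q - s) * τ ^ s := by gcongr
    _ = _ := by rw [h3]; ring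

/-- Keeps X away from zero, so that rounding T up to an integer costs only a constant factor. -/
lemma X_ge (h : Nontrivial q μ c κ L τ R ε r) : 1 / (4 * 2 ^ q) ≤ L * τ ^ q * r ^ κ / ε := by
  have hτ : 0 < τ := by linarith [h.τ_ge]
  have h1 := h.one_le_two_τ_rpow (s := q) (by linarith [h.two_le])
  have h2 : R ^ κ ≤ r ^ κ := Real.rpow_le_rpow h.R_pos.le h.R_le_r (by linarith [h.one_lt])
  have hL := h.L_pos
  have hR := h.R_pos
  have hr := h.r_pos
  rw [div_le_div_iff₀ (by positivity) h.ε_pos, one_mul]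
  calc ε ≤ 4 * (L * R ^ κ) * 1 := by rw [mul_one]; exact h.ε_le
    _ ≤ 4 * (L * r ^ κ) * (2 ^ q * τ ^ q) := by gcongr
    _ = _ := by ring

end Nontrivial

/-- The exponent in `T ^ ω`, the growth of the progress guarantee after `T` iterations. -/
noncomputable def growthExp (q κ : ℝ) : ℝ := (κ * q + κ - q) / κ

/-- The constant in front of the required growth. -/
noncomputable def growthConst (q κ c : ℝ) : ℝ :=
  (3 * q) ^ q * κ / (2 * c) * (2 ^ q * 4 / κ) ^ (q / κ)

/-- The radius of the proximal step for `T` iterations. -/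
noncomputable def proxRadius (κ L ε : ℝ) (T : ℕ) : ℝ := (κ * ε / (4 * L * T)) ^ (1 / κ)

/-- The leading coefficient of the step sizes. -/
noncomputable def stepCoeff (q c τ α : ℝ) : ℝ := α * c / (q ^ q * τ ^ (q - 1))

/-- The factor in the bound for the mirror iterates. -/
noncomputable def distConst (q c : ℝ) : ℝ := (3 * q * 3 ^ q / c) ^ (1 / q)

section

variable {q μ c κ L τ R ε r : ℝ} {T : ℕ}

lemma proxRadius_pos (hκ : 0 < κ) (hL : 0 < L) (hε : 0 < ε) (hT : 0 < T) :
    0 < proxRadius κ L ε T := by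
  unfold proxRadius; positivity

lemma proxRadius_rpow (hκ : 0 < κ) (hL : 0 < L) (hε : 0 < ε) :
    proxRadius κ L ε T ^ κ = κ * ε / (4 * L * T) := by
  rw [proxRadius, ← Real.rpow_mul (by positivity), one_div_mul_cancel hκ.ne', Real.rpow_one]

lemma Nontrivial.proxRadius_le (h : Nontrivial q μ c κ L τ R ε r) (hT : 0 < T) :
    proxRadius κ L ε T ≤ 2 * R := by
  have hκ : 0 < κ := by linarith [h.one_lt]
  have hR := h.R_pos
  have hL := h.L_pos
  have hε := h.ε_pos
  have hT1 : (1 : ℝ) ≤ T := by exact_mod_cast hT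
  refine (Real.rpow_le_rpow_iff (proxRadius_pos hκ h.L_pos h.ε_pos hT).le (by positivity) hκ).1 ?_
  rw [proxRadius_rpow hκ h.L_pos h.ε_pos, Real.mul_rpow two_pos.le hR.le,
    div_le_iff₀ (by positivity)]
  have h2 : (2 : ℝ) ≤ 2 ^ κ := by
    simpa using Real.rpow_le_rpow_of_exponent_le one_le_two h.one_lt.le
  have hRk : 0 < R ^ κ := by positivity
  calc κ * ε ≤ 2 * (4 * (L * R ^ κ)) := mul_le_mul h.le_two h.ε_le hε.le two_pos.le
    _ = 2 * R ^ κ * (4 * L * 1) := by ring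
    _ ≤ 2 ^ κ * R ^ κ * (4 * L * T) := by gcongr

/-- With enough iterations, the potential function argument yields accuracy `ε / 2`. -/
lemma Nontrivial.progress (h : Nontrivial q μ c κ L τ R ε r) (hT : 0 < T)
    (hTX : growthConst q κ c * (L * τ ^ q * r ^ κ / ε) ^ (q / κ) ≤ (T : ℝ) ^ growthExp q κ) :
    τ * (3 ^ q * R ^ q) ≤
      stepCoeff q c τ (μ * proxRadius κ L ε T ^ (q - κ) / L) * (T : ℝ) ^ q * (ε / 2) := by
  have hκ : 0 < κ := by linarith [h.one_lt]
  have hq : 0 < q := by linarith [h.two_le]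
  have hτ : 0 < τ := by linarith [h.τ_ge]
  have hR := h.R_pos
  have hL := h.L_pos
  have hε := h.ε_pos
  have hμ := h.μ_pos
  have hc := h.c_pos
  have hr := h.r_pos
  have hT0 : (0 : ℝ) < T := by exact_mod_cast hT
  set u := proxRadius κ L ε T with hu_def
  have hu : 0 < u := proxRadius_pos hκ hL hε hT
  have huκ : u ^ κ = κ * ε / (4 * L * T) := proxRadius_rpow hκ hL hε
  set X := L * τ ^ q * r ^ κ / ε with hX
  have hX0 : 0 < X := by positivity
  have hv : τ ^ q * r ^ q ≤ (2 ^ q * X * ε / L) ^ (q / κ) := by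
    have e1 : τ ^ q * r ^ q = (τ ^ κ * r ^ κ) ^ (q / κ) := by
      rw [← Real.mul_rpow hτ.le hr.le, ← Real.mul_rpow hτ.le hr.le,
        ← Real.rpow_mul (by positivity), mul_div_cancel₀ _ hκ.ne']
    rw [e1]
    refine Real.rpow_le_rpow (by positivity) ?_ (by positivity)
    have e2 : 2 ^ q * X * ε / L = 2 ^ q * τ ^ q * r ^ κ := by rw [hX]; field_simp
    rw [e2]
    gcongr
    exact h.τ_rpow_le hκ.le h.lt.le
  have huq : u ^ q * (T : ℝ) ^ (q + 1) = (κ * ε / (4 * L)) ^ (q / κ) * (T : ℝ) ^ growthExp q κ := by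
    have e1 : u ^ q = (κ * ε / (4 * L * T)) ^ (q / κ) := by
      rw [← huκ, ← Real.rpow_mul hu.le, mul_div_cancel₀ _ hκ.ne']
    have e2 : (T : ℝ) ^ (q + 1) = (T : ℝ) ^ (q / κ) * (T : ℝ) ^ growthExp q κ := by
      rw [← Real.rpow_add hT0]
      congr 1
      rw [growthExp]
      field_simp
      ring
    rw [e1, e2, ← mul_assoc, ← Real.mul_rpow (by positivity) hT0.le]
    congr 2
    field_simp
  -- The claim with the formulas for γ, α and u^κ inserted; `growthConst` is exactly what this
  -- inequality demands.
  have hmain : (3 * q) ^ q * κ / (2 * c) * (τ ^ q * r ^ q) ≤ u ^ q * (T : ℝ) ^ (q + 1) := by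
    rw [huq]
    calc (3 * q) ^ q * κ / (2 * c) * (τ ^ q * r ^ q)
        ≤ (3 * q) ^ q * κ / (2 * c) * (2 ^ q * X * ε / L) ^ (q / κ) := by gcongr
      _ = (κ * ε / (4 * L)) ^ (q / κ) * (growthConst q κ c * X ^ (q / κ)) := by
          have e1 : 2 ^ q * X * ε / L = κ * ε / (4 * L) * (2 ^ q * 4 / κ * X) := by
            field_simp
          have e2 : (2 ^ q * X * ε / L) ^ (q / κ) =
              (κ * ε / (4 * L)) ^ (q / κ) * ((2 ^ q * 4 / κ) ^ (q / κ) * X ^ (q / κ)) := by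
            rw [e1, Real.mul_rpow (by positivity) (by positivity),
              Real.mul_rpow (by positivity) hX0.le]
          rw [e2, growthConst]
          ring
      _ ≤ _ := by gcongr
  have e3 : u ^ (q - κ) = u ^ q * (4 * L * T) / (κ * ε) := by
    rw [Real.rpow_sub hu, huκ]
    field_simp
  have e4 : (T : ℝ) ^ (q + 1) = (T : ℝ) ^ q * T := Real.rpow_add_one hT0.ne' q
  have e5 : τ ^ q = τ ^ (q - 1) * τ := by rw [← Real.rpow_add_one hτ.ne', sub_add_cancel]
  have e6 : stepCoeff q c τ (μ * u ^ (q - κ) / L) * (T : ℝ) ^ q * (ε / 2) =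
      2 * c * μ / (κ * q ^ q * τ ^ (q - 1)) * (u ^ q * (T : ℝ) ^ (q + 1)) := by
    rw [stepCoeff, e3, e4]
    field_simp
    ring
  rw [e6]
  calc τ * (3 ^ q * R ^ q) = 2 * c * μ / (κ * q ^ q * τ ^ (q - 1)) *
        ((3 * q) ^ q * κ / (2 * c) * (τ ^ q * r ^ q)) := by
        rw [h.r_rpow, Real.mul_rpow (by norm_num) hq.le, e5]
        field_simp
    _ ≤ _ := by gcongr

/-- The mirror iterates stay within distance `distConst q c * r * T` of the star center. -/
lemma Nontrivial.dist_bound (h : Nontrivial q μ c κ L τ R ε r) (hT : 0 < T) {D : ℝ}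
    (hD : D ≤ 3 ^ q * R ^ q) :
    D + stepCoeff q c τ (μ * proxRadius κ L ε T ^ (q - κ) / L) * (T : ℝ) ^ q * (ε / (2 * τ)) ≤
      c * μ / q * (distConst q c * r * T) ^ q := by
  have hκ : 0 < κ := by linarith [h.one_lt]
  have hq2 := h.two_le
  have hq : 0 < q := by linarith [h.two_le]
  have hτ : 0 < τ := by linarith [h.τ_ge]
  have hR := h.R_pos
  have hL := h.L_pos
  have hε := h.ε_pos
  have hμ := h.μ_pos
  have hc := h.c_pos
  have hr := h.r_pos
  have hT0 : (0 : ℝ) < T := by exact_mod_cast hT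
  have hT1 : (1 : ℝ) ≤ (T : ℝ) ^ q := Real.one_le_rpow (by exact_mod_cast hT) hq.le
  set u := proxRadius κ L ε T with hu_def
  have hu : 0 < u := proxRadius_pos hκ hL hε hT
  -- Of the factor 3, one unit covers the initial divergence and two cover the accumulated errors.
  have e1 : c * μ / q * (distConst q c * r * T) ^ q = 3 * (3 ^ q * R ^ q * (T : ℝ) ^ q) := by
    rw [Real.mul_rpow (by unfold distConst; positivity) hT0.le,
      Real.mul_rpow (by unfold distConst; positivity) hr.le, h.r_rpow, distConst,
      ← Real.rpow_mul (by positivity), one_div_mul_cancel hq.ne', Real.rpow_one]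
    field_simp
  have e5 : τ ^ q = τ ^ (q - 1) * τ := by rw [← Real.rpow_add_one hτ.ne', sub_add_cancel]
  have h1 : u ^ (q - κ) * ε ≤ 4 * L * (2 ^ q * R ^ q) := by
    calc u ^ (q - κ) * ε ≤ (2 * R) ^ (q - κ) * (4 * (L * R ^ κ)) := by
          gcongr
          · linarith [h.lt]
          · exact h.proxRadius_le hT
          · exact h.ε_le
      _ ≤ (2 * R) ^ (q - κ) * (4 * (L * (2 * R) ^ κ)) := by
          gcongr
          linarith
      _ = 4 * L * ((2 * R) ^ (q - κ) * (2 * R) ^ κ) := by ring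
      _ = _ := by
          rw [← Real.rpow_add (by positivity), sub_add_cancel, Real.mul_rpow two_pos.le hR.le]
  have h2 : stepCoeff q c τ (μ * u ^ (q - κ) / L) * (T : ℝ) ^ q * (ε / (2 * τ)) ≤
      2 * (3 ^ q * R ^ q * (T : ℝ) ^ q) := by
    have e2 : stepCoeff q c τ (μ * u ^ (q - κ) / L) * (T : ℝ) ^ q * (ε / (2 * τ)) =
        c * μ * (u ^ (q - κ) * ε) * (T : ℝ) ^ q / (2 * L * q ^ q * τ ^ q) := by
      rw [stepCoeff, e5]
      field_simp
    rw [e2, div_le_iff₀ (by positivity)]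
    have h3 : c * μ ≤ 1 := mul_le_one₀ h.c_le hμ.le h.μ_le
    have h4 := h.one_le_two_τ_rpow hq.le
    have h5 : (2 : ℝ) ^ q ≤ q ^ q := Real.rpow_le_rpow two_pos.le hq2 hq.le
    have h6 : (2 : ℝ) ^ q ≤ 3 ^ q := Real.rpow_le_rpow two_pos.le (by norm_num) hq.le
    calc c * μ * (u ^ (q - κ) * ε) * (T : ℝ) ^ q
        ≤ 1 * (4 * L * (2 ^ q * R ^ q)) * (T : ℝ) ^ q := by gcongr
      _ = 4 * L * R ^ q * (T : ℝ) ^ q * 2 ^ q * 1 := by ring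
      _ ≤ 4 * L * R ^ q * (T : ℝ) ^ q * 3 ^ q * (2 ^ q * τ ^ q) := by gcongr
      _ ≤ 4 * L * R ^ q * (T : ℝ) ^ q * 3 ^ q * (q ^ q * τ ^ q) := by gcongr
      _ = _ := by ring
  have h3 : 3 ^ q * R ^ q ≤ 3 ^ q * R ^ q * (T : ℝ) ^ q :=
    le_mul_of_one_le_right (by positivity) hT1
  rw [e1]
  linarith

lemma three_le_distConst (hq : 2 ≤ q) (hc : 0 < c) (hc1 : c ≤ 1) : 3 ≤ distConst q c := by
  have hq0 : 0 < q := by linarith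
  have h1 : (3 : ℝ) ^ q ≤ 3 * q * 3 ^ q / c := by
    rw [le_div_iff₀ hc]
    have : (0 : ℝ) < 3 ^ q := by positivity
    nlinarith
  have h2 := Real.rpow_le_rpow (by positivity) h1 (one_div_nonneg.2 hq0.le)
  rwa [← Real.rpow_mul (by norm_num), mul_one_div_cancel hq0.ne', Real.rpow_one] at h2

/-- The constant in the bound for the number of bisections. -/
noncomputable def searchConst (q κ c : ℝ) : ℝ :=
  16 * 2 ^ q * (2 * (distConst q c * (5 * q) ^ (q / (q - κ)))) ^ κ

lemma Nontrivial.search_bound (h : Nontrivial q μ c κ L τ R ε r) (hT : 0 < T) :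
    (2 + T / τ) * (L / κ * (2 * (distConst q c * r * T *
      (1 + 4 * q * T) ^ (q / (q - κ)))) ^ κ) / (ε / (4 * τ)) ≤
      searchConst q κ c * (L * τ ^ q * r ^ κ / ε) *
        (T : ℝ) ^ (1 + κ * (1 + q / (q - κ))) := by
  have hκ : 0 < κ := by linarith [h.one_lt]
  have hq2 := h.two_le
  have hq : 0 < q := by linarith [h.two_le]
  have hτ : 0 < τ := by linarith [h.τ_ge]
  have hL := h.L_pos
  have hε := h.ε_pos
  have hc := h.c_pos
  have hr := h.r_pos
  have hb : 0 < distConst q c := by linarith [three_le_distConst hq2 hc h.c_le]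
  have hT1 : (1 : ℝ) ≤ T := by exact_mod_cast hT
  have hT0 : (0 : ℝ) < T := by linarith
  set N := q / (q - κ) with hN_def
  have hN : 0 ≤ N := div_nonneg hq.le (by linarith [h.lt])
  set b := distConst q c
  have h1 : 2 + T / τ ≤ 4 * T := by
    have : T / τ ≤ 2 * T := by
      rw [div_le_iff₀ hτ]; nlinarith [h.τ_ge]
    linarith
  have h2 : 1 + 4 * q * T ≤ 5 * q * T := by nlinarith
  have h3 : L / κ ≤ L := div_le_self hL.le h.one_lt.le
  have h4 : τ ≤ 2 ^ q * τ ^ q := by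
    simpa using h.τ_rpow_le zero_le_one (by linarith)
  calc (2 + T / τ) * (L / κ * (2 * (b * r * T * (1 + 4 * q * T) ^ N)) ^ κ) / (ε / (4 * τ))
      ≤ 4 * T * (L * (2 * (b * r * T * (5 * q * T) ^ N)) ^ κ) / (ε / (4 * τ)) := by gcongr
    _ = 16 * τ * (2 * (b * (5 * q) ^ N)) ^ κ * (L * r ^ κ / ε) *
        (T * (T ^ κ * (T ^ N) ^ κ)) := by
        have e1 : 2 * (b * r * T * (5 * q * T) ^ N) =
            2 * (b * (5 * q) ^ N) * (r * (T * (T : ℝ) ^ N)) := by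
          rw [Real.mul_rpow (by positivity) hT0.le]; ring
        rw [e1, Real.mul_rpow (by positivity) (by positivity), Real.mul_rpow hr.le (by positivity),
          Real.mul_rpow hT0.le (by positivity)]
        field_simp
        ring
    _ ≤ 16 * (2 ^ q * τ ^ q) * (2 * (b * (5 * q) ^ N)) ^ κ * (L * r ^ κ / ε) *
        (T * (T ^ κ * (T ^ N) ^ κ)) := by gcongr
    _ = searchConst q κ c * (L * τ ^ q * r ^ κ / ε) * (T * (T ^ κ * (T ^ N) ^ κ)) := by
        rw [searchConst]; ring
    _ = _ := by
        congr 1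
        rw [← Real.rpow_mul hT0.le, show 1 + κ * (1 + N) = 1 + κ + N * κ by ring,
          Real.rpow_add hT0, Real.rpow_add hT0, Real.rpow_one, mul_assoc]

end

end Constants

end StarConvexAcc

/-! ### Assembly of the complexity bound -/

namespace StarConvexAcc

lemma exists_nat_rpow_ge_mul {K x0 ω s X : ℝ} (hK : 0 < K) (hx0 : 0 < x0) (hω : 0 < ω)
    (hs : 0 ≤ s) (hX : x0 ≤ X) :
    ∃ T : ℕ, 0 < T ∧ K * X ^ s ≤ (T : ℝ) ^ ω ∧
      (T : ℝ) ≤ (K ^ (1 / ω) + (1 / x0) ^ (s / ω)) * X ^ (s / ω) := by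
  have hX0 : 0 < X := hx0.trans_le hX
  have hpos : 0 < K ^ (1 / ω) * X ^ (s / ω) := by positivity
  refine ⟨⌈K ^ (1 / ω) * X ^ (s / ω)⌉₊, Nat.ceil_pos.2 hpos, ?_, ?_⟩
  · calc K * X ^ s = (K ^ (1 / ω) * X ^ (s / ω)) ^ ω := by
          rw [Real.mul_rpow (by positivity) (by positivity), ← Real.rpow_mul hK.le,
            ← Real.rpow_mul hX0.le, one_div_mul_cancel hω.ne', div_mul_cancel₀ _ hω.ne',
            Real.rpow_one]
      _ ≤ _ := Real.rpow_le_rpow hpos.le (Nat.le_ceil _) hω.le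
  · have h1 : 1 ≤ (1 / x0) ^ (s / ω) * X ^ (s / ω) := by
      rw [← Real.mul_rpow (by positivity) hX0.le]
      refine Real.one_le_rpow ?_ (by positivity)
      rw [one_div_mul_eq_div, one_le_div hx0]
      exact hX
    have h2 := (Nat.ceil_lt_add_one hpos.le).le
    linarith

/-- The count carries a single logarithm Z; the square in the conclusion is slack, paid for by Z ≥
l. -/
lemma evaluations_le {T k n : ℕ} {K2 K5 l Y Z : ℝ} (hK2 : 0 ≤ K2) (hK5 : 0 ≤ K5) (hl : 0 < l)
    (hZ : l ≤ Z) (hY : 0 ≤ Y) (hT : T ≤ K2 * Y) (hk : k ≤ K5 * Z) (hn : n ≤ T * (3 * k + 8)) :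
    (n : ℝ) ≤ K2 * (3 * K5 / l + 8 / l ^ 2) * Y * Z ^ 2 := by
  have hZ0 : 0 < Z := hl.trans_le hZ
  have hn' : (n : ℝ) ≤ T * (3 * k + 8) := by exact_mod_cast hn
  have h1 : 3 * (k : ℝ) + 8 ≤ (3 * K5 / l + 8 / l ^ 2) * Z ^ 2 := by
    have e1 : 3 * (k : ℝ) ≤ 3 * K5 / l * Z ^ 2 := by
      calc 3 * (k : ℝ) ≤ 3 * (K5 * Z) := by gcongr
        _ = 3 * K5 / l * (l * Z) := by field_simp
        _ ≤ 3 * K5 / l * (Z * Z) := by gcongr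
        _ = _ := by ring
    have e2 : 8 ≤ 8 / l ^ 2 * Z ^ 2 := by
      rw [div_mul_eq_mul_div, le_div_iff₀ (by positivity)]
      gcongr
    linarith
  calc (n : ℝ) ≤ T * (3 * k + 8) := hn'
    _ ≤ K2 * Y * ((3 * K5 / l + 8 / l ^ 2) * Z ^ 2) := by gcongr
    _ = _ := by ring

set_option maxHeartbeats 1000000 in
/-- Complexity of the method for a uniformly convex distance-generating function. -/
theorem exists_solvesWithin {q κ c : ℝ} (hq : 2 ≤ q) (hκ : 1 < κ) (hκ2 : κ ≤ 2) (hκq : κ < q)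
    (hc : 0 < c) (hc1 : c ≤ 1) :
    ∃ M : ℝ, 0 < M ∧ ∀ p μ : ℝ, 1 < p → p ≤ q → 0 < μ → μ ≤ 1 →
      DgfUniformlyConvex p q (c * μ) →
      ∀ L τ R ε : ℝ, 0 < L → 0 < τ → 0 < R → 0 < ε →
      ∃ (T : ℕ) (P : Params), P.Valid ∧
        SolvesWithin p q μ κ L τ R ε P T
          (M * (L * τ ^ q * (R / μ ^ (1 / q)) ^ κ / ε) ^ (q / (κ * q + κ - q)) *
            Real.log (2 + L * τ ^ q * (R / μ ^ (1 / q)) ^ κ / ε) ^ 2) := by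
  have hκ0 : 0 < κ := by linarith
  have hq0 : 0 < q := by linarith
  have hden : 0 < κ * q + κ - q := by nlinarith
  have hω : 0 < growthExp q κ := div_pos hden hκ0
  have hK : 0 < growthConst q κ c := by unfold growthConst; positivity
  set E := q / (κ * q + κ - q) with hE
  have hE0 : 0 < E := div_pos hq0 hden
  have hEω : q / κ / growthExp q κ = E := by
    rw [hE, growthExp]; field_simp
  set K2 := growthConst q κ c ^ (1 / growthExp q κ) +
    (1 / (1 / (4 * 2 ^ q))) ^ (q / κ / growthExp q κ) with hK2
  have hK20 : 0 < K2 := by positivity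
  set n1 := 1 + κ * (1 + q / (q - κ)) with hn1
  have hn10 : 0 < n1 := by
    have : 0 < q / (q - κ) := div_pos hq0 (by linarith)
    positivity
  set K4 := searchConst q κ c * K2 ^ n1
  obtain ⟨K5, hK5, hbis⟩ := exists_nat_rpow_ge (K := max K4 1) (n := 1 + E * n1) (a := κ - 1)
    (le_max_right _ _) (by positivity) (by linarith)
  have hl2 : 0 < Real.log 2 := Real.log_pos one_lt_two
  refine ⟨K2 * (3 * K5 / Real.log 2 + 8 / Real.log 2 ^ 2), by positivity, ?_⟩
  intro p μ hp hpq hμ hμ1 huc L τ R ε hL hτ hR hε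
  set r := R / μ ^ (1 / q) with hr_def
  have hr : 0 < r := by positivity
  set X := L * τ ^ q * r ^ κ / ε with hX_def
  have hX : 0 < X := by positivity
  have hbound : 0 ≤ K2 * (3 * K5 / Real.log 2 + 8 / Real.log 2 ^ 2) * X ^ E *
      Real.log (2 + X) ^ 2 := by positivity
  have hp0 : 0 < p := by linarith
  -- Two degenerate regimes with T = 0: for τ < 1/2 one has τκ < 1 and F is constant; for ε > 4LR^κ
  -- the starting point is already accurate enough.
  rcases lt_or_ge τ (1 / 2) with hτ2 | hτ2
  · refine ⟨0, ⟨fun _ => 0, fun _ => 1, fun _ => 1, fun _ => 1⟩,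
      ⟨fun _ => le_rfl, fun _ => one_pos, fun _ => one_pos, fun _ => one_pos⟩,
      solvesWithin_zero _ hbound fun d F x1 xs hS hF _ _ => ?_⟩
    have := eq_of_mul_lt_one hp0 hτ (by nlinarith) hS hF x1
    linarith
  rcases lt_or_ge (4 * (L * R ^ κ)) ε with hεR | hεR
  · refine ⟨0, ⟨fun _ => 0, fun _ => 1, fun _ => 1, fun _ => 1⟩,
      ⟨fun _ => le_rfl, fun _ => one_pos, fun _ => one_pos, fun _ => one_pos⟩,
      solvesWithin_zero _ hbound fun d F x1 xs hS hF h1 h2 => ?_⟩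
    have h3 := sub_min_le hS hF x1
    have h4 : lpNorm p (x1 - xs) ^ κ ≤ 4 * R ^ κ := by
      calc lpNorm p (x1 - xs) ^ κ ≤ (2 * R) ^ κ :=
            Real.rpow_le_rpow (lpNorm_nonneg _ _) (by linarith [lpNorm_sub_le hp.le x1 xs]) hκ0.le
        _ = 2 ^ κ * R ^ κ := Real.mul_rpow two_pos.le hR.le
        _ ≤ 4 * R ^ κ := by
            have : (2 : ℝ) ^ κ ≤ 2 ^ (2 : ℝ) := Real.rpow_le_rpow_of_exponent_le one_le_two hκ2
            norm_num at this
            gcongr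
    have h5 : L / κ * lpNorm p (x1 - xs) ^ κ ≤ L * (4 * R ^ κ) :=
      mul_le_mul (div_le_self hL.le hκ.le) h4 (Real.rpow_nonneg (lpNorm_nonneg _ _) _) hL.le
    linarith
  have hN : Nontrivial q μ c κ L τ R ε r :=
    ⟨hq, hκ, hκ2, hκq, hc, hc1, hμ, hμ1, hL, hR, hε, hτ2, hεR, hr_def⟩
  obtain ⟨T, hT, hTX, hTle⟩ := exists_nat_rpow_ge_mul hK
    (by positivity : (0 : ℝ) < 1 / (4 * 2 ^ q)) hω (by positivity : 0 ≤ q / κ) hN.X_ge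
  rw [← hX_def, hEω, ← hEω, ← hK2, hEω] at hTle
  obtain ⟨k, hk, hkle⟩ := hbis (2 + X) (by linarith)
  have hT0 : (0 : ℝ) < T := by exact_mod_cast hT
  set u := proxRadius κ L ε T
  have hu : 0 < u := proxRadius_pos hκ0 hL hε hT
  set α := μ * u ^ (q - κ) / L with hα_def
  have hα : 0 < α := by positivity
  set γ := stepCoeff q c τ α with hγ_def
  have hγ : 0 < γ := by rw [hγ_def, stepCoeff]; positivity
  have hb := three_le_distConst hq hc hc1
  have hrT : R ≤ r * T := hN.R_le_r.trans
    (le_mul_of_one_le_right hr.le (by exact_mod_cast hT))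
  have hBR : 2 * R ≤ distConst q c * r * T := by
    rw [mul_assoc]
    nlinarith
  have hδ : L * u ^ κ / κ = ε / (4 * T) := by
    rw [proxRadius_rpow hκ0 hL hε]; field_simp
  have hconst : RunConst p q μ (c * μ) κ L τ u α (ε / (4 * T)) γ (ε / (4 * τ))
      (distConst q c * r * T) T :=
    { one_lt := hκ, le := hκq.le, L_pos := hL, μ_pos := hμ, u_pos := hu, α_eq := rfl,
      δ_eq := hδ.symm, one_lt_p := hp, p_le_q := hpq, two_le := hq, lt := hκq,
      m_pos := by positivity, τ_pos := hτ, e_pos := by positivity, γ_pos := hγ,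
      γ_le := by
        rw [hγ_def, stepCoeff]
        apply le_of_eq
        field_simp
      u_le := (hN.proxRadius_le hT).trans hBR
      convex := huc }
  refine ⟨T, accParams q τ α γ (ε / (4 * τ)),
    accParams_valid hγ hq0 hτ hα (by positivity), ?_⟩
  intro d F x1 xs hS hF hx1 hxs
  have hD := bregman_dgf_le hp.le hq (by positivity) huc hx1 hxs
  have hB := hN.dist_bound hT hD
  have he : ε / (4 * τ) + T * (ε / (4 * T)) / τ = ε / (2 * τ) := by field_simp; ring
  rw [← he] at hB
  have hsearch : (2 + T / τ) * (L / κ * (2 * (distConst q c * r * T *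
      (1 + 4 * q * T) ^ (q / (q - κ)))) ^ κ) / (ε / (4 * τ)) ≤ (2 ^ k) ^ (κ - 1) := by
    refine (hN.search_bound hT).trans (le_trans ?_ hk)
    have hsc : 0 ≤ searchConst q κ c := by
      unfold searchConst
      positivity
    calc searchConst q κ c * X * (T : ℝ) ^ n1
        ≤ searchConst q κ c * X * (K2 * X ^ E) ^ n1 := by gcongr
      _ = K4 * X ^ (1 + E * n1) := by
          rw [Real.mul_rpow hK20.le (by positivity), ← Real.rpow_mul hX.le, Real.rpow_add hX,
            Real.rpow_one]
          ring
      _ ≤ max K4 1 * (2 + X) ^ (1 + E * n1) := by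
          gcongr
          · exact le_max_left _ _
          · linarith
  obtain ⟨⟨x, y, n, hrun⟩, hall⟩ := hconst.exists_run hS hF
    ((lpNorm_sub_le hp.le x1 xs).trans (by linarith)) hB hsearch T le_rfl
  refine ⟨⟨y, n, x, hrun⟩, fun y n hret => ?_⟩
  obtain ⟨x, hrun⟩ := hret
  obtain ⟨hinv, hn⟩ := hall x y n hrun
  constructor
  -- The errors amount to Γ_T ε/2, and so does the bound for the initial divergence; dividing by Γ_T
  -- gives ε.
  · have hpot := hinv.potential
    have hprog := hN.progress hT hTX
    have hbr : 0 ≤ bregman (dgf p q) xs x :=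
      le_trans (mul_nonneg (by positivity) (Real.rpow_nonneg (lpNorm_nonneg _ _) _)) (huc d x xs)
    have hΓ : 0 < γ * (T : ℝ) ^ q := by positivity
    have he2 : τ * (ε / (4 * τ)) + T * (ε / (4 * T)) = ε / 2 := by field_simp; ring
    rw [he2] at hpot
    have h1 : τ * bregman (dgf p q) xs x1 ≤ τ * (3 ^ q * R ^ q) := by gcongr
    have h2 : 0 ≤ τ * bregman (dgf p q) xs x := by positivity
    have h3 : γ * (T : ℝ) ^ q * (F y - F xs) ≤ γ * (T : ℝ) ^ q * ε := by linarith
    linarith [le_of_mul_le_mul_left h3 hΓ]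
  · have hZ : Real.log 2 ≤ Real.log (2 + X) := Real.log_le_log two_pos (by linarith)
    exact evaluations_le hK20.le hK5 hl2 hZ (by positivity) hTle hkle hn

lemma log_two_add_le {X Λ j : ℝ} (hΛ : 2 ≤ Λ) (hX : 0 < X) (hj : 1 ≤ j) (h : X ≤ Λ ^ j) :
    Real.log (2 + X) ≤ (j + 1) * Real.log Λ := by
  have hΛ0 : 0 < Λ := by linarith
  have h1 : Λ ≤ Λ ^ j := by
    simpa using Real.rpow_le_rpow_of_exponent_le (by linarith : 1 ≤ Λ) hj
  rw [← Real.log_rpow hΛ0]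
  refine Real.log_le_log (by linarith) ?_
  rw [Real.rpow_add_one hΛ0.ne']
  nlinarith

lemma dgfUniformlyConvex_two {p : ℝ} (hp : 1 < p) (hp2 : p ≤ 2) :
    DgfUniformlyConvex p 2 (1 / 20 * (p - 1)) :=
  fun _ x y => bregman_dgf_two_ge hp hp2 x y

/-- The prescribed μ is below the available constant 2^(2-p), because p/(p-1) ≥ 1. -/
lemma dgfUniformlyConvex_self {p : ℝ} (hp : 2 < p) :
    DgfUniformlyConvex p p (1 * 2 ^ (-(p * (p - 2) / (p - 1)))) := by
  intro d x y
  refine le_trans ?_ (bregman_dgf_self_ge hp.le x y)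
  have h0 := lpNorm_nonneg p (y - x)
  have hle : -(p * (p - 2) / (p - 1)) ≤ 2 - p := by
    rw [neg_le, le_div_iff₀ (by linarith)]
    nlinarith
  rw [one_mul]
  gcongr
  norm_num

lemma rpow_le_rpow_of_le_base {a Λ s t : ℝ} (ha : 0 ≤ a) (hs : 0 ≤ s) (hΛ : 1 ≤ Λ)
    (hab : a ≤ Λ) (hst : s ≤ t) : a ^ s ≤ Λ ^ t :=
  (Real.rpow_le_rpow ha hab hs).trans (Real.rpow_le_rpow_of_exponent_le hΛ hst)

end StarConvexAcc

open StarConvexAcc in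
theorem corollary3 :
    -- (i)  `1 < p ≤ 2`, `q = 2`, `μ = p - 1`; the constant `M` depends on `κ` only
    (∀ κ : ℝ, 1 < κ → κ < 2 →
      ∃ M : ℝ, 0 < M ∧
        ∀ p : ℝ, 1 < p → p ≤ 2 →
        ∀ L τ R ε : ℝ, 0 < L → 0 < τ → 0 < R → 0 < ε →
        ∃ (T : ℕ) (P : StarConvexAcc.Params), P.Valid ∧
          StarConvexAcc.SolvesWithin p 2 (p - 1) κ L τ R ε P T
            (M * (L * τ ^ (2 : ℝ) * (R / Real.sqrt (p - 1)) ^ κ / ε) ^ (2 / (3 * κ - 2)) *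
              Real.log (2 + L * τ ^ (2 : ℝ) * (R / Real.sqrt (p - 1)) ^ κ / ε) ^ 2) ∧
          (2 ≤ L * τ * R / ε → τ ≤ L * τ * R / ε → R ≤ L * τ * R / ε →
            1 / (p - 1) ≤ L * τ * R / ε →
            StarConvexAcc.SolvesWithin p 2 (p - 1) κ L τ R ε P T
              (M * (L * τ ^ (2 : ℝ) * (R / Real.sqrt (p - 1)) ^ κ / ε) ^ (2 / (3 * κ - 2)) *
                Real.log (L * τ * R / ε) ^ 2))) ∧
    -- (ii)  `p > 2`, `q = p`, `μ = 2 ^ (-p (p - 2) / (p - 1))`; `M` depends on `p` and `κ` only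
    (∀ p κ : ℝ, 2 < p → 1 < κ → κ ≤ 2 →
      ∃ M : ℝ, 0 < M ∧
        ∀ L τ R ε : ℝ, 0 < L → 0 < τ → 0 < R → 0 < ε →
        ∃ (T : ℕ) (P : StarConvexAcc.Params), P.Valid ∧
          StarConvexAcc.SolvesWithin p p ((2 : ℝ) ^ (-(p * (p - 2) / (p - 1)))) κ L τ R ε P T
            (M * (L * τ ^ p * R ^ κ / ε) ^ (p / (κ * p + κ - p)) *
              Real.log (2 + L * τ ^ p * R ^ κ / ε) ^ 2) ∧
          (2 ≤ L * τ * R / ε → τ ≤ L * τ * R / ε → R ≤ L * τ * R / ε →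
            StarConvexAcc.SolvesWithin p p ((2 : ℝ) ^ (-(p * (p - 2) / (p - 1)))) κ L τ R ε P T
              (M * (L * τ ^ p * R ^ κ / ε) ^ (p / (κ * p + κ - p)) *
                Real.log (L * τ * R / ε) ^ 2))) := by
  constructor
  · intro κ hκ hκ2
    obtain ⟨M, hM, h⟩ := exists_solvesWithin (q := 2) (c := 1 / 20) le_rfl hκ hκ2.le hκ2
      (by norm_num) (by norm_num)
    -- The factor 5² is used for the second bound: X ≤ Λ^4 gives log(2 + X) ≤ 5 log Λ.
    refine ⟨5 ^ 2 * M, by positivity, ?_⟩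
    intro p hp hp2 L τ R ε hL hτ hR hε
    have hp1 : 0 < p - 1 := by linarith
    obtain ⟨T, P, hP, hsolve⟩ := h p (p - 1) hp hp2 hp1 (by linarith)
      (dgfUniformlyConvex_two hp hp2) L τ R ε hL hτ hR hε
    rw [← Real.sqrt_eq_rpow, show κ * 2 + κ - 2 = 3 * κ - 2 by ring] at hsolve
    have hsq : 0 < √(p - 1) := Real.sqrt_pos.2 hp1
    set X := L * τ ^ (2 : ℝ) * (R / √(p - 1)) ^ κ / ε with hX_def
    have hX : 0 < X := by positivity
    refine ⟨T, P, hP, hsolve.mono ?_, fun h2 hτΛ hRΛ hpΛ => hsolve.mono ?_⟩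
    · have : 0 ≤ M * X ^ (2 / (3 * κ - 2)) * Real.log (2 + X) ^ 2 := by positivity
      linarith
    · set Λ := L * τ * R / ε with hΛ
      have hΛ1 : 1 ≤ Λ := by linarith
      have hXΛ : X ≤ Λ ^ (4 : ℝ) := by
        have h1 : R ^ (κ - 1) ≤ Λ ^ (1 : ℝ) :=
          rpow_le_rpow_of_le_base hR.le (by linarith) hΛ1 hRΛ (by linarith)
        have h2 : (1 / (p - 1)) ^ (κ / 2) ≤ Λ ^ (1 : ℝ) :=
          rpow_le_rpow_of_le_base (by positivity) (by positivity) hΛ1 hpΛ (by linarith)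
        have e1 : X = Λ * τ * R ^ (κ - 1) * (1 / (p - 1)) ^ (κ / 2) := by
          rw [hX_def, hΛ, Real.div_rpow hR.le hsq.le, Real.sqrt_eq_rpow, ← Real.rpow_mul hp1.le,
            Real.div_rpow zero_le_one hp1.le, Real.one_rpow, show 1 / 2 * κ = κ / 2 by ring,
            Real.rpow_sub_one hR.ne', Real.rpow_two]
          field_simp
        rw [Real.rpow_one] at h1 h2
        calc X = Λ * τ * R ^ (κ - 1) * (1 / (p - 1)) ^ (κ / 2) := e1
          _ ≤ Λ * Λ * Λ * Λ := by gcongr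
          _ = Λ ^ (4 : ℝ) := by
              rw [show (4 : ℝ) = ((4 : ℕ) : ℝ) by norm_num, Real.rpow_natCast]; ring
      have hlog := log_two_add_le h2 hX (by norm_num) hXΛ
      have hlog0 : 0 ≤ Real.log (2 + X) := Real.log_nonneg (by linarith)
      calc M * X ^ (2 / (3 * κ - 2)) * Real.log (2 + X) ^ 2
          ≤ M * X ^ (2 / (3 * κ - 2)) * ((4 + 1) * Real.log Λ) ^ 2 := by gcongr
        _ = _ := by ring
  · intro p κ hp hκ hκ2
    obtain ⟨M, hM, h⟩ := exists_solvesWithin (q := p) (c := 1) hp.le hκ hκ2 (by linarith)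
      one_pos le_rfl
    set μ : ℝ := 2 ^ (-(p * (p - 2) / (p - 1))) with hμ_def
    have hμ : 0 < μ := by positivity
    have hμ1 : μ ≤ 1 := Real.rpow_le_one_of_one_le_of_nonpos one_le_two
      (neg_nonpos.2 (div_nonneg (mul_nonneg (by linarith) (by linarith)) (by linarith)))
    set ν := μ ^ (1 / p) with hν_def
    have hν : 0 < ν := by positivity
    have hν1 : ν ≤ 1 := Real.rpow_le_one hμ.le hμ1 (one_div_nonneg.2 (by linarith))
    -- The general bound involves R / μ^(1/p). Here μ depends on p only, so K and j, which remove it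
    -- from X and from the logarithm, may enter the constant.
    set K := (ν ^ κ)⁻¹ with hK_def
    have hK : 1 ≤ K := (one_le_inv₀ (by positivity)).2 (Real.rpow_le_one hν.le hν1 (by linarith))
    set E := p / (κ * p + κ - p) with hE
    have hl2 : 0 < Real.log 2 := Real.log_pos one_lt_two
    set j := Real.log K / Real.log 2 + 1 with hj
    have hj1 : 1 ≤ j := by
      have := Real.log_nonneg hK
      have : 0 ≤ Real.log K / Real.log 2 := by positivity
      linarith
    -- The factor (p + 2)² comes from X ≤ Λ^(p+1) in the second bound.
    refine ⟨(p + 2) ^ 2 * (j ^ 2 * (M * K ^ E)), by positivity, ?_⟩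
    intro L τ R ε hL hτ hR hε
    obtain ⟨T, P, hP, hsolve⟩ := h p μ (by linarith) le_rfl hμ hμ1
      (dgfUniformlyConvex_self hp) L τ R ε hL hτ hR hε
    set X := L * τ ^ p * R ^ κ / ε with hX_def
    have hX : 0 < X := by positivity
    have hKX : L * τ ^ p * (R / ν) ^ κ / ε = K * X := by
      rw [Real.div_rpow hR.le hν.le, hK_def, hX_def]
      field_simp
    rw [hKX] at hsolve
    have hlogK : Real.log (2 + K * X) ≤ j * Real.log (2 + X) := by
      have h1 : 2 + K * X ≤ K * (2 + X) := by nlinarith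
      have h2 : Real.log 2 ≤ Real.log (2 + X) := Real.log_le_log two_pos (by linarith)
      have h3 : Real.log K ≤ Real.log K / Real.log 2 * Real.log (2 + X) := by
        rw [div_mul_eq_mul_div, le_div_iff₀ hl2]
        have := Real.log_nonneg hK
        gcongr
      calc Real.log (2 + K * X) ≤ Real.log (K * (2 + X)) := Real.log_le_log (by positivity) h1
        _ = Real.log K + Real.log (2 + X) := Real.log_mul (by positivity) (by positivity)
        _ ≤ _ := by rw [hj]; linarith
    have hlogK0 : 0 ≤ Real.log (2 + K * X) := Real.log_nonneg (by nlinarith)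
    have hfirst : M * (K * X) ^ E * Real.log (2 + K * X) ^ 2 ≤
        j ^ 2 * (M * K ^ E) * X ^ E * Real.log (2 + X) ^ 2 := by
      calc M * (K * X) ^ E * Real.log (2 + K * X) ^ 2
          ≤ M * (K * X) ^ E * (j * Real.log (2 + X)) ^ 2 := by gcongr
        _ = _ := by rw [Real.mul_rpow (by positivity) hX.le]; ring
    replace hsolve := hsolve.mono hfirst
    refine ⟨T, P, hP, hsolve.mono ?_, fun h2 hτΛ hRΛ => hsolve.mono ?_⟩
    · have h1 : 0 ≤ j ^ 2 * (M * K ^ E) * X ^ E * Real.log (2 + X) ^ 2 := by positivity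
      have h2 : 1 ≤ (p + 2) ^ 2 := by nlinarith
      nlinarith
    · set Λ := L * τ * R / ε with hΛ
      have hΛ1 : 1 ≤ Λ := by linarith
      have hXΛ : X ≤ Λ ^ (p + 1) := by
        have h1 : R ^ (κ - 1) ≤ Λ ^ (1 : ℝ) :=
          rpow_le_rpow_of_le_base hR.le (by linarith) hΛ1 hRΛ (by linarith)
        have h2 : τ ^ (p - 1) ≤ Λ ^ (p - 1) :=
          Real.rpow_le_rpow hτ.le hτΛ (by linarith)
        have e1 : X = Λ * τ ^ (p - 1) * R ^ (κ - 1) := by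
          rw [hX_def, hΛ, Real.rpow_sub_one hR.ne', Real.rpow_sub_one hτ.ne']
          field_simp
        calc X = Λ * τ ^ (p - 1) * R ^ (κ - 1) := e1
          _ ≤ Λ * Λ ^ (p - 1) * Λ ^ (1 : ℝ) := by gcongr
          _ = Λ ^ (p + 1) := by
              nth_rewrite 1 [← Real.rpow_one Λ]
              rw [← Real.rpow_add (by linarith), ← Real.rpow_add (by linarith)]
              congr 1
              ring
      have hlog := log_two_add_le h2 hX (by linarith) hXΛ
      have hlog0 : 0 ≤ Real.log (2 + X) := Real.log_nonneg (by linarith)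
      calc j ^ 2 * (M * K ^ E) * X ^ E * Real.log (2 + X) ^ 2
          ≤ j ^ 2 * (M * K ^ E) * X ^ E * ((p + 1 + 1) * Real.log Λ) ^ 2 := by gcongr
        _ = _ := by ring
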